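/- Let $M$ be an open connected subset of $\mathbb R^n$ and let $X_1,\dots,X_k$ be smooth vector fields on $M$ such that, for some constants $K,L\in\mathbb R$ and all $i$ and all $x,y\in M$, $$\|X_i(x)\|\le K,\qquad \|X_i(x)-X_i(y)\|\le L\,\|x-y\| .$$ Let $H$ be the distribution on $M$ spanned by $X_1,\dots,X_k$, i.e. $H_x=\operatorname{span}\{X_1(x),\dots,X_k(x)\}$ for $x\in M$. A horizontal vector field is a smooth vector field $Y$ on an open set $U\subseteq M$ with $Y(y)\in H_y$ for all $y\in U$. A curve $\gamma:[a,b]\to M$ is controlled by local vector fields $Y_1,\dots,Y_m$ defined near $\gamma([a,b])$ if it is absolutely continuous and there are $u_1,\dots,u_m\in L^1([a,b])$ with $\dot\gamma(t)=\sum_{i} u_i(t)\,Y_i(\gamma(t))$ for almost every $t$; a horizontal curve is a finite concatenation of curves controlled by horizontal vector fields. The accessible set $Acc(x)$ of $x\in M$ is the set of all points of $M$ that can be reached from $x$ by a horizontal curve. The endpoint map $\operatorname{End}_x$ is defined at those controls $u\in L^1([0,1];\mathbb R^k)$ for which the problem $$\dot\gamma(t)=\sum_{i=1}^k u_i(t)\,X_i(\gamma(t))\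 \text{ for almost every } t,\qquad \gamma(0)=x$$ has a unique absolutely continuous solution $\gamma:[0,1]\to M$, and then $\operatorname{End}_x(u)=\gamma(1)$. A subset $N\subseteq M$ is an initial submanifold of $M$ if for every $y\in N$ there are $r\in\{0,\dots,n\}$ and a smooth chart $\varphi:W\to\mathbb R^n$ of $M$ with $\varphi(y)=0$ and $\varphi(C_y(W\cap N))=\varphi(W)\cap(\mathbb R^r\times\{0\})$, where $C_y(A)$ is the set of points that can be joined to $y$ by a smooth curve $[0,1]\to M$ lying in $A$. Such a $\varphi$ is called an initial submanifold chart at $y$, and a vector $v\in\mathbb R^n$ is tangent to $N$ at $y$ if $D\varphi(y)v\in\mathbb R^r\times\{0\}$ in every initial submanifold chart $\varphi$ at $y$. Theorem. For every $x\in M$, $$Acc(x)=\operatorname{End}_x\bigl(\operatorname{dom}(\operatorname{End}_x)\bigr).$$ Moreover this image is an initial submanifold of $M$, and horizontal vector fields are tangent to it: for every horizontal vector field $Y$ on an open set $U\subseteq M$ and every $y\in U$ in the image of $\operatorname{End}_x$, the vector $Y(y)$ is tangent to the image at $y$. -/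

import Mathlib

open Set MeasureTheory
open scoped ContDiff

namespace SubRiem

/-- A distribution `H` on `M ⊆ ℝⁿ` is spanned by the vector fields `X₁, …, X_k`.
Only the values of `H` on `M` matter. -/
def SpannedBy {n k : ℕ} (M : Set (EuclideanSpace ℝ (Fin n)))
    (H : EuclideanSpace ℝ (Fin n) → Submodule ℝ (EuclideanSpace ℝ (Fin n)))
    (X : Fin k → EuclideanSpace ℝ (Fin n) → EuclideanSpace ℝ (Fin n)) : Prop :=
  ∀ x ∈ M, H x = Submodule.span ℝ (range fun i => X i x)

/-- `Y` is a smooth local horizontal vector field with open domain `U ⊆ M`. -/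
structure IsLocalHorizontal {n : ℕ} (M : Set (EuclideanSpace ℝ (Fin n)))
    (H : EuclideanSpace ℝ (Fin n) → Submodule ℝ (EuclideanSpace ℝ (Fin n)))
    (U : Set (EuclideanSpace ℝ (Fin n)))
    (Y : EuclideanSpace ℝ (Fin n) → EuclideanSpace ℝ (Fin n)) : Prop where
  isOpen : IsOpen U
  subset : U ⊆ M
  smooth : ContDiffOn ℝ ∞ Y U
  horizontal : ∀ y ∈ U, Y y ∈ H y

/-- On `[a, b]` the curve `γ` is absolutely continuous, the functions `u₁, …, u_m` are
integrable, and `γ' = ∑ i, u i • Y i ∘ γ` almost everywhere. -/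
structure IsControlledBy {n m : ℕ}
    (Y : Fin m → EuclideanSpace ℝ (Fin n) → EuclideanSpace ℝ (Fin n))
    (u : Fin m → ℝ → ℝ) (γ : ℝ → EuclideanSpace ℝ (Fin n)) (a b : ℝ) : Prop where
  absCont : AbsolutelyContinuousOnInterval γ a b
  integrable : ∀ i, IntervalIntegrable (u i) volume a b
  deriv_eq : ∀ᵐ t ∂(volume.restrict (Icc a b)), HasDerivAt γ (∑ i, u i t • Y i (γ t)) t

/-- On `[a, b]` the curve `γ` is controlled by finitely many local horizontal vector fields,
each of which is defined near `γ([a, b])`. -/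
def IsControlledHorizontal {n : ℕ} (M : Set (EuclideanSpace ℝ (Fin n)))
    (H : EuclideanSpace ℝ (Fin n) → Submodule ℝ (EuclideanSpace ℝ (Fin n)))
    (γ : ℝ → EuclideanSpace ℝ (Fin n)) (a b : ℝ) : Prop :=
  ∃ (m : ℕ) (U : Fin m → Set (EuclideanSpace ℝ (Fin n)))
    (Y : Fin m → EuclideanSpace ℝ (Fin n) → EuclideanSpace ℝ (Fin n)) (u : Fin m → ℝ → ℝ),
    (∀ i, IsLocalHorizontal M H (U i) (Y i)) ∧ (∀ i, MapsTo γ (Icc a b) (U i)) ∧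
      IsControlledBy Y u γ a b

/-- `γ : [a, b] → M` is a horizontal curve: a (finite) concatenation of curves controlled by
horizontal vector fields. -/
def IsHorizontalCurve {n : ℕ} (M : Set (EuclideanSpace ℝ (Fin n)))
    (H : EuclideanSpace ℝ (Fin n) → Submodule ℝ (EuclideanSpace ℝ (Fin n)))
    (γ : ℝ → EuclideanSpace ℝ (Fin n)) (a b : ℝ) : Prop :=
  MapsTo γ (Icc a b) M ∧
    ∃ (N : ℕ) (t : ℕ → ℝ), Monotone t ∧ t 0 = a ∧ t N = b ∧
      ∀ j < N, IsControlledHorizontal M H γ (t j) (t (j + 1))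

/-- The accessible set of `x`: all points that can be reached from `x` by a horizontal curve. -/
def accessibleSet {n : ℕ} (M : Set (EuclideanSpace ℝ (Fin n)))
    (H : EuclideanSpace ℝ (Fin n) → Submodule ℝ (EuclideanSpace ℝ (Fin n)))
    (x : EuclideanSpace ℝ (Fin n)) : Set (EuclideanSpace ℝ (Fin n)) :=
  {y | ∃ (a b : ℝ) (γ : ℝ → EuclideanSpace ℝ (Fin n)),
    a ≤ b ∧ IsHorizontalCurve M H γ a b ∧ γ a = x ∧ γ b = y}

/-- The Banach space `L¹([0,1]; ℝᵏ)` of controls. -/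
abbrev Controls (k : ℕ) : Type :=
  Lp (EuclideanSpace ℝ (Fin k)) 1 (volume.restrict (Icc (0 : ℝ) 1))

/-- `γ : [0,1] → M` solves `γ' = ∑ i, u i • X i ∘ γ`, `γ 0 = x`. -/
def IsSolution {n k : ℕ} (M : Set (EuclideanSpace ℝ (Fin n)))
    (X : Fin k → EuclideanSpace ℝ (Fin n) → EuclideanSpace ℝ (Fin n))
    (u : Controls k) (x : EuclideanSpace ℝ (Fin n)) (γ : ℝ → EuclideanSpace ℝ (Fin n)) : Prop :=
  MapsTo γ (Icc 0 1) M ∧ γ 0 = x ∧ IsControlledBy X (fun i t => u t i) γ 0 1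

/-- The pairs `(u, x)` for which the initial value problem has exactly one solution on the whole
interval `[0,1]`. (Solutions are functions on `ℝ`, so they are identified if they agree
on `[0,1]`.) -/
def solvableSet {n k : ℕ} (M : Set (EuclideanSpace ℝ (Fin n)))
    (X : Fin k → EuclideanSpace ℝ (Fin n) → EuclideanSpace ℝ (Fin n)) :
    Set (Controls k × EuclideanSpace ℝ (Fin n)) :=
  {p | (∃ γ, IsSolution M X p.1 p.2 γ) ∧
    ∀ γ γ', IsSolution M X p.1 p.2 γ → IsSolution M X p.1 p.2 γ' → EqOn γ γ' (Icc 0 1)}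

/-- The endpoint map `u ↦ γ(1)`, a partial function on the space of controls, where `γ` is the
solution with control `u` and initial value `x`. -/
noncomputable def endpointMap {n k : ℕ} (M : Set (EuclideanSpace ℝ (Fin n)))
    (X : Fin k → EuclideanSpace ℝ (Fin n) → EuclideanSpace ℝ (Fin n))
    (x : EuclideanSpace ℝ (Fin n)) : Controls k →. EuclideanSpace ℝ (Fin n) :=
  fun u => ⟨(u, x) ∈ solvableSet M X, fun h => h.1.choose 1⟩

/-- `C_{x₀}(A)`: the points of `A` that can be connected to `x₀` by a smooth curve in `A`. -/
def smoothComponent {n : ℕ} (A : Set (EuclideanSpace ℝ (Fin n)))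
    (x₀ : EuclideanSpace ℝ (Fin n)) : Set (EuclideanSpace ℝ (Fin n)) :=
  {y | ∃ c : ℝ → EuclideanSpace ℝ (Fin n),
    ContDiffOn ℝ ∞ c (Icc 0 1) ∧ MapsTo c (Icc 0 1) A ∧ c 0 = x₀ ∧ c 1 = y}

/-- The subspace `ℝʳ × {0}` of `ℝⁿ`. -/
def coordSubspace (n r : ℕ) : Submodule ℝ (EuclideanSpace ℝ (Fin n)) where
  carrier := {z | ∀ i : Fin n, r ≤ (i : ℕ) → z i = 0}
  add_mem' := fun {v w} hv hw i hi => by simp [hv i hi, hw i hi]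
  zero_mem' := fun i _ => by simp
  smul_mem' := fun c v hv i hi => by simp [hv i hi]

/-- `φ` is a smooth chart of the open set `M ⊆ ℝⁿ`, centered at `y`, which is an initial
submanifold chart of dimension `r` for the subset `N`. -/
structure IsInitialChart {n : ℕ} (M N : Set (EuclideanSpace ℝ (Fin n)))
    (y : EuclideanSpace ℝ (Fin n))
    (φ : OpenPartialHomeomorph (EuclideanSpace ℝ (Fin n)) (EuclideanSpace ℝ (Fin n)))
    (r : ℕ) : Prop where
  source_subset : φ.source ⊆ M
  smooth : ContDiffOn ℝ ∞ φ φ.source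
  smooth_symm : ContDiffOn ℝ ∞ φ.symm φ.target
  mem_source : y ∈ φ.source
  centered : φ y = 0
  le_dim : r ≤ n
  image_eq : φ '' smoothComponent (φ.source ∩ N) y = φ.target ∩ coordSubspace n r

/-- `N` is an initial submanifold of the open set `M ⊆ ℝⁿ`. -/
def IsInitialSubmanifold {n : ℕ} (M N : Set (EuclideanSpace ℝ (Fin n))) : Prop :=
  N ⊆ M ∧ ∀ y ∈ N, ∃ φ r, IsInitialChart M N y φ r

/-- The vector `v` at `y` is tangent to the initial submanifold `N` of `M`: in initial
submanifold charts `φ` centered at `y`, where `N` looks like `ℝʳ × {0}`, the vector `v`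
corresponds to an element of `ℝʳ × {0}`. -/
def IsTangentAt {n : ℕ} (M N : Set (EuclideanSpace ℝ (Fin n)))
    (y v : EuclideanSpace ℝ (Fin n)) : Prop :=
  ∀ φ r, IsInitialChart M N y φ r → fderiv ℝ φ y v ∈ coordSubspace n r

end SubRiem

/-! Both sets are identified with one orbit. The `X i` are cut off by countably many bump functions
that equal one on balls covering `M`. The cut-off fields are smooth with compact support, so they
have smooth global flows (`exists_smoothFlow`), and these preserve `M`. Let O be the orbit of `x`
under the group generated by the flows.

The orbit theorem describes O. Pushing the generators forward by all words gives an invariant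
distribution `orbitTangent`, whose rank r is constant on O. Flowing along r conjugated generators
from a transversal gives a chart (`exists_orbit_chart`) whose r-dimensional slices lie in single
orbits and, at points of O, are tangent to `orbitTangent`. Moreover O is a countable union of images
of smooth maps whose derivatives lie in `orbitTangent`. Hence transverse coordinates take only
countably many values on O (`countable_transverse_values`), a continuous curve in O cannot change
them, and O is an initial submanifold.

Three inclusions close the circle. A solution is a horizontal curve, so the image of the endpoint
map is accessible. Accessible points lie in O: in an orbit chart the transverse part of a horizontal
field vanishes on the central slice and is Lipschitz, so Grönwall's argument keeps the curve in the
slice (`eventually_sameOrbit`). Finally, a word in the flows is a concatenation of flow lines, with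
the cut-off factors absorbed into the controls (`reachesIn_act`); the Lipschitz hypothesis on `X`
makes the solution unique. Tangency holds because flow lines of generators are smooth curves in O.
-/

namespace SubRiem

open scoped Topology

/-! ### Smoothness of composition operators on spaces of continuous functions -/

section Nemytskii

universe v

variable {T : Type*} [TopologicalSpace T] [CompactSpace T]
  {E F : Type v} [NormedAddCommGroup E] [NormedSpace ℝ E] [NormedAddCommGroup F] [NormedSpace ℝ F]

/-- Pointwise application of a continuous family of operators to a continuous function. -/
noncomputable def pointwiseApply : C(T, E →L[ℝ] F) →L[ℝ] C(T, E) →L[ℝ] C(T, F) :=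
  LinearMap.mkContinuous₂
    (LinearMap.mk₂ ℝ (fun (A : C(T, E →L[ℝ] F)) (h : C(T, E)) =>
      (⟨fun s => A s (h s), A.continuous.clm_apply h.continuous⟩ : C(T, F)))
      (fun A B h => by ext; simp) (fun c A h => by ext; simp) (fun A h k => by ext; simp)
      (fun c A h => by ext; simp)) 1 (fun A h => by
        rw [ContinuousMap.norm_le _ (by positivity)]
        intro s
        simp only [LinearMap.mk₂_apply, ContinuousMap.coe_mk, one_mul]
        exact ((A s).le_opNorm _).trans (by
          gcongr
          · exact A.norm_coe_le_norm s
          · exact h.norm_coe_le_norm s))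

lemma norm_pointwiseApply_le (A : C(T, E →L[ℝ] F)) : ‖pointwiseApply A‖ ≤ ‖A‖ := by
  refine ContinuousLinearMap.opNorm_le_bound _ (norm_nonneg A) fun h => ?_
  rw [ContinuousMap.norm_le _ (by positivity)]
  intro s
  exact ((A s).le_opNorm _).trans (by
    gcongr
    · exact A.norm_coe_le_norm s
    · exact h.norm_coe_le_norm s)

/-- The range of `γ` is compact, so continuity of `f'` is uniform along it: one `δ` serves every
point, and the mean value inequality gives a remainder bound uniform in `s`. -/
lemma hasFDerivAt_comp_left (f : C(E, F)) (f' : C(E, E →L[ℝ] F))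
    (hf : ∀ x, HasFDerivAt f (f' x) x) (γ : C(T, E)) :
    HasFDerivAt (fun γ : C(T, E) => f.comp γ) (pointwiseApply (f'.comp γ)) γ := by
  rw [hasFDerivAt_iff_isLittleO_nhds_zero, Asymptotics.isLittleO_iff]
  intro ε hε
  have hK : IsCompact (range γ) := isCompact_range γ.continuous
  have := hK.uniformContinuousAt_of_continuousAt f' (fun a _ => f'.continuous.continuousAt)
    (Metric.dist_mem_uniformity hε)
  obtain ⟨δ, hδ, hδ'⟩ := Metric.mem_uniformity_dist.1 this
  filter_upwards [Metric.ball_mem_nhds (0 : C(T, E)) hδ] with h hh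
  rw [ContinuousMap.norm_le _ (by positivity)]
  intro s
  have hs : ‖h s‖ ≤ ‖h‖ := h.norm_coe_le_norm s
  have hh' : ‖h‖ < δ := by simpa using hh
  have key := (convex_ball (γ s) δ).norm_image_sub_le_of_norm_hasFDerivWithin_le'
    (f := f) (f' := f') (φ := f' (γ s)) (C := ε) (x := γ s) (y := γ s + h s)
    (fun x _ => (hf x).hasFDerivWithinAt) (fun x hx => by
      have := hδ' (a := γ s) (b := x) (by rw [dist_comm]; exact hx) ⟨s, rfl⟩
      rw [← dist_eq_norm, dist_comm]; exact this.le) (Metric.mem_ball_self hδ)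
    (by simpa using hs.trans_lt hh')
  simp only [add_sub_cancel_left] at key
  exact key.trans (mul_le_mul_of_nonneg_left hs hε.le)

/-- The derivative is again a composition operator, by `fderiv ℝ f`, followed by a bounded linear
map. The induction therefore replaces `F` by `E →L[ℝ] F`, which is why `F` is quantified inside and
shares a universe with `E`. -/
lemma contDiff_nat_comp_left (n : ℕ) : ∀ {F : Type v} [NormedAddCommGroup F] [NormedSpace ℝ F]
    (f : C(E, F)), ContDiff ℝ n f → ContDiff ℝ n (fun γ : C(T, E) => f.comp γ) := by
  induction n with
  | zero =>
    intro F _ _ f _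
    rw [CharP.cast_eq_zero, contDiff_zero]
    exact ContinuousMap.continuous_postcomp f
  | succ n ih =>
    intro F _ _ f hf
    push_cast at hf ⊢
    have h1 : ContDiff ℝ n (fderiv ℝ f) := hf.fderiv_right le_rfl
    rw [contDiff_succ_iff_hasFDerivAt]
    let f' : C(E, E →L[ℝ] F) := ⟨fderiv ℝ f, h1.continuous⟩
    have h2 : ContDiff ℝ n fun A : C(T, E →L[ℝ] F) => pointwiseApply A :=
      ContinuousLinearMap.contDiff _
    exact ⟨fun γ => pointwiseApply (f'.comp γ), h2.comp (ih f' h1),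
      fun γ => hasFDerivAt_comp_left f f' (fun x => (hf.differentiable (by simp) x).hasFDerivAt) γ⟩

/-- Composition with a smooth map is smooth on spaces of continuous functions. -/
lemma contDiff_comp_left (f : C(E, F)) (hf : ContDiff ℝ ∞ f) :
    ContDiff ℝ ∞ (fun γ : C(T, E) => f.comp γ) :=
  contDiff_infty.2 fun n => contDiff_nat_comp_left n f (contDiff_infty.1 hf n)

end Nemytskii

/-! ### Global integral curves of bounded Lipschitz fields -/

section GlobalFlow

variable {E : Type*} [NormedAddCommGroup E] [NormedSpace ℝ E] [CompleteSpace E]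

lemma exists_integralCurve {Z : E → E} {K B : NNReal} (hL : LipschitzWith K Z)
    (hB : ∀ x, ‖Z x‖ ≤ B) (x : E) :
    ∃ γ : ℝ → E, γ 0 = x ∧ ∀ t, HasDerivAt γ (Z (γ t)) t := by
  have hloc : ∀ T : ℝ, 0 < T → ∃ γ : ℝ → E, γ 0 = x ∧
      ∀ t ∈ Ioo (-T) T, HasDerivAt γ (Z (γ t)) t := by
    intro T hT
    -- With speed at most `B`, a curve stays within distance `B * T` up to time `T`, so this radius
    -- works for every `T`.
    have hpl : IsPicardLindelof (fun _ => Z) (tmin := -T) (tmax := T)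
        ⟨0, by simp [hT.le]⟩ x (B * T.toNNReal) 0 B K :=
      { lipschitzOnWith := fun t _ => hL.lipschitzOnWith
        continuousOn := fun x _ => continuousOn_const
        norm_le := fun t _ x _ => hB x
        mul_max_le := by simp [hT.le] }
    obtain ⟨γ, h0, hγ⟩ := hpl.exists_eq_forall_mem_Icc_hasDerivWithinAt₀
    exact ⟨γ, h0, fun t ht => (hγ t (Ioo_subset_Icc_self ht)).hasDerivAt (Icc_mem_nhds ht.1 ht.2)⟩
  choose! γ h0 hγ using hloc
  have heq : ∀ S T : ℝ, 0 < S → S ≤ T → EqOn (γ S) (γ T) (Ioo (-S) S) := by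
    intro S T hS hST
    refine ODE_solution_unique_of_mem_Ioo (v := fun _ => Z) (s := fun _ => univ) (K := K) (t₀ := 0)
      (fun _ _ => hL.lipschitzOnWith) ⟨by linarith, hS⟩ (fun t ht => ⟨hγ S hS t ht, trivial⟩)
      (fun t ht => ⟨hγ T (hS.trans_le hST) t ⟨by linarith [ht.1], by linarith [ht.2]⟩, trivial⟩) ?_
    rw [h0 S hS, h0 T (hS.trans_le hST)]
  -- The local solutions agree on overlaps, so at time `t` any interval containing `t` in its
  -- interior may be used.
  refine ⟨fun t => γ (|t| + 1) t, h0 _ (by positivity), fun t => ?_⟩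
  have hd := hγ (|t| + 2) (by positivity) t (abs_lt.1 (by linarith))
  have hev : (fun s => γ (|s| + 1) s) =ᶠ[𝓝 t] γ (|t| + 2) := by
    have : ∀ᶠ s in 𝓝 t, |s| < |t| + 1 := continuous_abs.continuousAt.eventually_lt_const (by linarith)
    filter_upwards [this] with s hs
    exact heq _ _ (by positivity) (by linarith) (abs_lt.1 (by linarith))
  have h2 := hd.congr_of_eventuallyEq hev
  rwa [← hev.self_of_nhds] at h2

/-- The smooth global flows: smooth actions of the additive group `ℝ`. -/
structure SmoothFlow (E : Type*) [NormedAddCommGroup E] [NormedSpace ℝ E] where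
  toFun : ℝ → E → E
  smooth : ContDiff ℝ ∞ (fun p : ℝ × E => toFun p.1 p.2)
  zero_apply : ∀ x, toFun 0 x = x
  add_apply : ∀ s t x, toFun (s + t) x = toFun s (toFun t x)

end GlobalFlow

/-! ### The integration operator on the unit interval -/

section Volterra

open scoped unitInterval

variable {E : Type*} [NormedAddCommGroup E] [NormedSpace ℝ E]

/-- The primitive of a continuous function on the unit interval. -/
noncomputable def primitiveMap : C(I, E) →L[ℝ] C(I, E) :=
  LinearMap.mkContinuous
    { toFun := fun γ => ⟨fun s => ∫ r in (0 : ℝ)..s, γ (projIcc 0 1 zero_le_one r), by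
        have : Continuous fun r : ℝ => γ (projIcc 0 1 zero_le_one r) :=
          γ.continuous.comp continuous_projIcc
        exact (intervalIntegral.continuous_primitive
          (fun a b => this.intervalIntegrable a b) 0).comp continuous_subtype_val⟩
      map_add' := fun γ η => by
        ext s
        simp only [ContinuousMap.add_apply, ContinuousMap.coe_mk]
        exact intervalIntegral.integral_add
          ((γ.continuous.comp continuous_projIcc).intervalIntegrable _ _)
          ((η.continuous.comp continuous_projIcc).intervalIntegrable _ _)
      map_smul' := fun c γ => by
        ext s
        simp } 1 (fun γ => by
      rw [ContinuousMap.norm_le _ (by positivity)]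
      intro s
      have h := intervalIntegral.norm_integral_le_of_norm_le_const (a := (0 : ℝ)) (b := s)
        (f := fun r => γ (projIcc 0 1 zero_le_one r)) (C := ‖γ‖)
        (fun r _ => γ.norm_coe_le_norm _)
      refine h.trans ?_
      have h1 := s.2.1
      have h2 := s.2.2
      rw [sub_zero, abs_of_nonneg h1, mul_comm]
      gcongr)

lemma primitiveMap_apply (γ : C(I, E)) (s : I) :
    primitiveMap γ s = ∫ r in (0 : ℝ)..s, γ (projIcc 0 1 zero_le_one r) := rfl

lemma norm_primitiveMap_le : ‖(primitiveMap : C(I, E) →L[ℝ] C(I, E))‖ ≤ 1 :=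
  LinearMap.mkContinuous_norm_le _ zero_le_one _

lemma primitiveMap_sub_le {Z : C(E, E)} {K : NNReal} (hL : LipschitzWith K Z) (γ η : C(I, E)) :
    ‖primitiveMap (Z.comp γ) - primitiveMap (Z.comp η)‖ ≤ K * ‖γ - η‖ := by
  have h := (primitiveMap (E := E)).le_of_opNorm_le norm_primitiveMap_le (Z.comp γ - Z.comp η)
  rw [map_sub, one_mul] at h
  refine h.trans ?_
  rw [ContinuousMap.norm_le _ (by positivity)]
  intro s
  refine (hL.norm_sub_le (γ s) (η s)).trans ?_
  gcongr
  exact (γ - η).norm_coe_le_norm s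

end Volterra

/-! ### Smooth dependence on time and initial value by the implicit function theorem -/

section FlowSmooth

open scoped unitInterval

variable {E : Type*} [NormedAddCommGroup E] [NormedSpace ℝ E] [CompleteSpace E]

/-- The integral equation of the flow of `Z` up to time `t`, rescaled to the unit interval. -/
noncomputable def flowEquation (Z : C(E, E)) (p : (ℝ × E) × C(I, E)) : C(I, E) :=
  p.2 - ContinuousMap.const I p.1.2 - p.1.1 • primitiveMap (Z.comp p.2)

omit [CompleteSpace E] in
lemma contDiff_flowEquation {Z : C(E, E)} (hZ : ContDiff ℝ ∞ Z) :
    ContDiff ℝ ∞ (flowEquation Z) := by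
  have h1 : ContDiff ℝ ∞ fun p : (ℝ × E) × C(I, E) => ContinuousMap.const I p.1.2 :=
    ContDiff.comp (g := fun x : E => ContinuousMap.const I x)
      (ContinuousLinearMap.const ℝ I : E →L[ℝ] C(I, E)).contDiff (contDiff_snd.comp contDiff_fst)
  have h2 : ContDiff ℝ ∞ fun p : (ℝ × E) × C(I, E) => primitiveMap (Z.comp p.2) :=
    primitiveMap.contDiff.comp ((contDiff_comp_left Z hZ).comp contDiff_snd)
  exact (contDiff_snd.sub h1).sub ((contDiff_fst.comp contDiff_fst).smul h2)

/-- The partial derivative in the curve is `1 - A`, where `A` is time times integration after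
multiplication by the derivative of `Z`. Its norm is at most `|t| * K < 1`, so the Neumann series
inverts it. -/
lemma isInvertible_fderiv_flowEquation {Z : C(E, E)} (hZ : ContDiff ℝ ∞ Z) {K : NNReal}
    (hL : LipschitzWith K Z) (u : (ℝ × E) × C(I, E)) (hu : |u.1.1| * K < 1) :
    (fderiv ℝ (flowEquation Z) u ∘L .inr ℝ (ℝ × E) C(I, E)).IsInvertible := by
  let Z' : C(E, E →L[ℝ] E) := ⟨fderiv ℝ Z, hZ.continuous_fderiv (by simp)⟩
  have hZ' : ∀ x, HasFDerivAt Z (Z' x) x := fun x => (hZ.differentiable (by simp) x).hasFDerivAt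
  let A : C(I, E) →L[ℝ] C(I, E) := u.1.1 • (primitiveMap ∘L pointwiseApply (Z'.comp u.2))
  have hA : ‖A‖ < 1 := by
    refine lt_of_le_of_lt (ContinuousLinearMap.opNorm_le_bound A (by positivity) fun h => ?_) hu
    have h1 : ‖Z'.comp u.2‖ ≤ K := by
      rw [ContinuousMap.norm_le _ (by positivity)]
      exact fun s => norm_fderiv_le_of_lipschitz ℝ hL
    have h2 := (pointwiseApply (Z'.comp u.2)).le_of_opNorm_le
      ((norm_pointwiseApply_le _).trans h1) h
    have h3 := (primitiveMap (E := E)).le_of_opNorm_le norm_primitiveMap_le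
      (pointwiseApply (Z'.comp u.2) h)
    rw [one_mul] at h3
    have h4 : ‖A h‖ = |u.1.1| * ‖primitiveMap (pointwiseApply (Z'.comp u.2) h)‖ := by
      rw [← Real.norm_eq_abs]
      exact norm_smul u.1.1 (primitiveMap (pointwiseApply (Z'.comp u.2) h) : C(I, E))
    rw [h4, mul_assoc]
    exact mul_le_mul_of_nonneg_left (h3.trans h2) (abs_nonneg _)
  have h1 : HasFDerivAt (fun γ => flowEquation Z (u.1, γ)) (1 - A) u.2 := by
    have h := ((hasFDerivAt_id u.2).sub_const (ContinuousMap.const I u.1.2)).sub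
      ((primitiveMap.hasFDerivAt.comp u.2 (hasFDerivAt_comp_left Z Z' hZ' u.2)).const_smul u.1.1)
    exact h
  have h2 : HasFDerivAt (fun γ => flowEquation Z (u.1, γ))
      (fderiv ℝ (flowEquation Z) u ∘L .inr ℝ (ℝ × E) C(I, E)) u.2 :=
    HasFDerivAt.comp (f := fun γ : C(I, E) => (u.1, γ)) (g := flowEquation Z) u.2
      ((contDiff_flowEquation hZ).differentiable (by simp) u).hasFDerivAt
      (hasFDerivAt_prodMk_right u.1 u.2)
  rw [h2.unique h1]
  exact ⟨ContinuousLinearEquiv.unitsEquiv ℝ _ (Units.oneSub A hA), rfl⟩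

omit [CompleteSpace E] in
lemma flowEquation_injective {Z : C(E, E)} {K : NNReal} (hL : LipschitzWith K Z) {p : ℝ × E}
    (hp : |p.1| * K < 1) {γ η : C(I, E)} (h : flowEquation Z (p, γ) = flowEquation Z (p, η)) :
    γ = η := by
  have h1 : γ - η = p.1 • (primitiveMap (Z.comp γ) - primitiveMap (Z.comp η)) := by
    simp only [flowEquation] at h
    rw [smul_sub, ← sub_eq_zero, ← sub_eq_zero.2 h]
    abel
  have h2 : ‖γ - η‖ ≤ |p.1| * K * ‖γ - η‖ := by
    conv_lhs => rw [h1]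
    rw [norm_smul, Real.norm_eq_abs, mul_assoc]
    gcongr
    exact primitiveMap_sub_le hL γ η
  by_contra hne
  have : 0 < ‖γ - η‖ := norm_pos_iff.2 (sub_ne_zero.2 hne)
  nlinarith

/-- The solution with initial value `p.2` up to time `p.1`, rescaled to the unit interval. -/
noncomputable def flowCurve (Φ : ℝ → E → E) (hc : ∀ x, Continuous fun t => Φ t x) (p : ℝ × E) :
    C(I, E) :=
  ⟨fun s => Φ (p.1 * s) p.2, (hc p.2).comp (by fun_prop)⟩

lemma flowEquation_flowCurve {Z : C(E, E)} {Φ : ℝ → E → E} (h0 : ∀ x, Φ 0 x = x)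
    (hd : ∀ x t, HasDerivAt (fun t => Φ t x) (Z (Φ t x)) t) (hc : ∀ x, Continuous fun t => Φ t x)
    (p : ℝ × E) : flowEquation Z (p, flowCurve Φ hc p) = 0 := by
  ext s
  have h1 : ∀ r, HasDerivAt (fun r => Φ (p.1 * r) p.2) (p.1 • Z (Φ (p.1 * r) p.2)) r := fun r => by
    have := (hd p.2 (p.1 * r)).scomp r ((hasDerivAt_id r).const_mul p.1)
    rw [mul_one] at this
    exact this
  have h2 : ∫ r in (0 : ℝ)..s, p.1 • Z (Φ (p.1 * r) p.2) = Φ (p.1 * s) p.2 - Φ (p.1 * 0) p.2 :=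
    intervalIntegral.integral_eq_sub_of_hasDerivAt (fun r _ => h1 r)
      (Continuous.intervalIntegrable ((Z.continuous.comp ((hc p.2).comp (by fun_prop))).const_smul _)
        _ _)
  have h3 : ∫ r in (0 : ℝ)..s, p.1 • Z (Φ (p.1 * r) p.2) =
      p.1 • primitiveMap (Z.comp (flowCurve Φ hc p)) s := by
    rw [intervalIntegral.integral_smul, primitiveMap_apply]
    congr 1
    refine intervalIntegral.integral_congr fun r hr => ?_
    rw [uIcc_of_le s.2.1] at hr
    have hr' : r ∈ Icc (0 : ℝ) 1 := ⟨hr.1, hr.2.trans s.2.2⟩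
    simp [flowCurve, projIcc_of_mem _ hr']
  rw [h3] at h2
  simp only [flowEquation, ContinuousMap.sub_apply, ContinuousMap.smul_apply, h2,
    ContinuousMap.const_apply, ContinuousMap.zero_apply]
  simp [flowCurve, h0]

/-- The implicit function theorem gives a smooth family of curves solving the integral equation;
`flowEquation_injective` identifies them with the flow curves, and evaluation at `1` is linear and
continuous. -/
lemma contDiffAt_flow_of_small {Z : C(E, E)} (hZ : ContDiff ℝ ∞ Z) {K : NNReal}
    (hL : LipschitzWith K Z) {Φ : ℝ → E → E} (h0 : ∀ x, Φ 0 x = x)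
    (hd : ∀ x t, HasDerivAt (fun t => Φ t x) (Z (Φ t x)) t) (p : ℝ × E) (hp : |p.1| * K < 1) :
    ContDiffAt ℝ ∞ (fun p : ℝ × E => Φ p.1 p.2) p := by
  have hc : ∀ x, Continuous fun t => Φ t x := fun x =>
    continuous_iff_continuousAt.2 fun t => (hd x t).continuousAt
  let u : (ℝ × E) × C(I, E) := (p, flowCurve Φ hc p)
  have cdf : ContDiffAt ℝ ∞ (flowEquation Z) u := (contDiff_flowEquation hZ).contDiffAt
  have hinv := isInvertible_fderiv_flowEquation hZ hL u hp
  have hψ := cdf.contDiffAt_implicitFunction (by simp) hinv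
  have hev := cdf.eventually_apply_implicitFunction (by simp) hinv
  have hsmall : ∀ᶠ q : ℝ × E in 𝓝 p, |q.1| * K < 1 :=
    have : ContinuousAt (fun q : ℝ × E => |q.1| * (K : ℝ)) p := by fun_prop
    this.eventually (gt_mem_nhds hp)
  have heval : ContDiffAt ℝ ∞
      (fun q => (cdf.implicitFunction (by simp) hinv q : C(I, E)) 1) p :=
    ContDiffAt.comp (g := fun γ : C(I, E) => γ 1) p
      (ContinuousMap.evalCLM ℝ (1 : I) : C(I, E) →L[ℝ] E).contDiff.contDiffAt hψ
  refine heval.congr_of_eventuallyEq ?_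
  filter_upwards [hev, hsmall] with q hq hqs
  have : flowEquation Z (q, cdf.implicitFunction (by simp) hinv q) =
      flowEquation Z (q, flowCurve Φ hc q) := by
    rw [hq, flowEquation_flowCurve h0 hd hc]
    exact (flowEquation_flowCurve (Z := Z) h0 hd hc q).symm
  rw [flowEquation_injective hL hqs this]
  simp [flowCurve]

/-- A smooth, bounded, Lipschitz vector field generates a smooth global flow. -/
theorem exists_smoothFlow {Z : E → E} (hZ : ContDiff ℝ ∞ Z) {K B : NNReal}
    (hL : LipschitzWith K Z) (hB : ∀ x, ‖Z x‖ ≤ B) :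
    ∃ Φ : SmoothFlow E, ∀ x t, HasDerivAt (fun t => Φ.toFun t x) (Z (Φ.toFun t x)) t := by
  choose φ h0 hd using exists_integralCurve hL hB
  let Φ : ℝ → E → E := fun t x => φ x t
  have hadd : ∀ s t x, Φ (s + t) x = Φ s (Φ t x) := by
    intro s t x
    have h1 : ∀ s, HasDerivAt (fun s => Φ (s + t) x) (Z (Φ (s + t) x)) s := fun s =>
      (hd x (s + t)).comp_add_const s t
    exact congrFun (ODE_solution_unique_univ (v := fun _ => Z) (s := fun _ => univ) (t₀ := 0)
      (fun _ => hL.lipschitzOnWith) (fun t => ⟨h1 t, trivial⟩)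
      (fun s => ⟨hd (Φ t x) s, trivial⟩) (by simp [Φ, h0])) s
  -- Long times are reached by repeated halving: the flow for time t is the flow for time t/2
  -- applied twice.
  have hsmall : ∀ m : ℕ, ∀ p : ℝ × E, |p.1| * K < 2 ^ m →
      ContDiffAt ℝ ∞ (fun p : ℝ × E => Φ p.1 p.2) p := by
    intro m
    induction m with
    | zero =>
      intro p hp
      exact contDiffAt_flow_of_small (Z := ⟨Z, hZ.continuous⟩) hZ hL h0 hd p (by simpa using hp)
    | succ m ih =>
      intro p hp
      have hp2 : |p.1 / 2| * K < 2 ^ m := by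
        rw [abs_div, abs_two]
        rw [pow_succ] at hp
        linarith
      have heq : (fun p : ℝ × E => Φ p.1 p.2) = fun p => Φ (p.1 / 2) (Φ (p.1 / 2) p.2) := by
        ext p
        rw [← hadd, add_halves]
      rw [heq]
      have hin : ContDiffAt ℝ ∞ (fun p : ℝ × E => (p.1 / 2, p.2)) p :=
        (contDiffAt_fst.div_const 2).prodMk contDiffAt_snd
      have h1 : ContDiffAt ℝ ∞ (fun p : ℝ × E => Φ (p.1 / 2) p.2) p :=
        
          ContDiffAt.comp (g := fun p : ℝ × E => Φ p.1 p.2) (f := fun p : ℝ × E => (p.1 / 2, p.2)) p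
          (ih (p.1 / 2, p.2) hp2) hin
      exact ContDiffAt.comp (g := fun p : ℝ × E => Φ p.1 p.2)
        (f := fun p : ℝ × E => (p.1 / 2, Φ (p.1 / 2) p.2)) p (ih (p.1 / 2, Φ (p.1 / 2) p.2) hp2)
        ((contDiffAt_fst.div_const 2).prodMk h1)
  refine ⟨⟨Φ, contDiff_iff_contDiffAt.2 fun p => ?_, h0, hadd⟩, hd⟩
  obtain ⟨m, hm⟩ := pow_unbounded_of_one_lt (|p.1| * K) (one_lt_two)
  exact hsmall m p hm

end FlowSmooth

/-! ### Generators and derivatives of smooth flows -/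

namespace SmoothFlow

variable {E : Type*} [NormedAddCommGroup E] [NormedSpace ℝ E] (Φ : SmoothFlow E)

/-- The infinitesimal generator of a flow. -/
noncomputable def field (x : E) : E := deriv (fun t => Φ.toFun t x) 0

lemma smooth_apply (t : ℝ) : ContDiff ℝ ∞ (Φ.toFun t) :=
  Φ.smooth.comp (contDiff_const.prodMk contDiff_id)

lemma smooth_orbit (x : E) : ContDiff ℝ ∞ (fun t => Φ.toFun t x) :=
  Φ.smooth.comp (contDiff_id.prodMk contDiff_const)

lemma neg_apply (t : ℝ) (x : E) : Φ.toFun (-t) (Φ.toFun t x) = x := by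
  rw [← Φ.add_apply, neg_add_cancel, Φ.zero_apply]

lemma hasDerivAt_zero (x : E) : HasDerivAt (fun t => Φ.toFun t x) (Φ.field x) 0 :=
  ((Φ.smooth_orbit x).differentiable (by simp) 0).hasDerivAt

lemma hasDerivAt (t : ℝ) (x : E) :
    HasDerivAt (fun t => Φ.toFun t x) (Φ.field (Φ.toFun t x)) t := by
  have h := (Φ.hasDerivAt_zero (Φ.toFun t x))
  rw [← sub_self t] at h
  have h2 := HasDerivAt.comp_sub_const t t h
  simpa only [← Φ.add_apply, sub_add_cancel] using h2

lemma fderiv_uncurry (t : ℝ) (x : E) (s : ℝ) (y : E) :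
    fderiv ℝ (fun p : ℝ × E => Φ.toFun p.1 p.2) (t, x) (s, y) =
      s • Φ.field (Φ.toFun t x) + fderiv ℝ (Φ.toFun t) x y := by
  have hd : HasFDerivAt (fun p : ℝ × E => Φ.toFun p.1 p.2) _ (t, x) :=
    (Φ.smooth.differentiable (by simp) (t, x)).hasFDerivAt
  have h1 := (HasFDerivAt.comp (f := fun y => (t, y)) x hd (hasFDerivAt_prodMk_right t x)).fderiv
  have h2 := (HasFDerivAt.comp (f := fun s => (s, x)) t hd (hasFDerivAt_prodMk_left t x)).hasDerivAt
  have h3 := h2.unique (Φ.hasDerivAt t x)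
  have h4 : ((s, y) : ℝ × E) = s • (1, 0) + (0, y) := by simp
  rw [h4, map_add, map_smul, ← h3]
  congr 1
  exact (DFunLike.congr_fun h1 y).symm

end SmoothFlow

/-! ### Orbits and the invariant distribution -/

section Orbit

variable {E : Type*} [NormedAddCommGroup E] [NormedSpace ℝ E] {ι : Type*} (Φ : ι → SmoothFlow E)

/-- The action of a word in the flows. -/
def act : List (ι × ℝ) → E → E
  | [], x => x
  | p :: w, x => (Φ p.1).toFun p.2 (act w x)

@[simp] lemma act_nil (x : E) : act Φ [] x = x := rfl

@[simp] lemma act_cons (p : ι × ℝ) (w : List (ι × ℝ)) (x : E) :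
    act Φ (p :: w) x = (Φ p.1).toFun p.2 (act Φ w x) := rfl

lemma act_append (w w' : List (ι × ℝ)) (x : E) : act Φ (w ++ w') x = act Φ w (act Φ w' x) := by
  induction w with
  | nil => rfl
  | cons p w ih => simp [ih]

lemma contDiff_act (w : List (ι × ℝ)) : ContDiff ℝ ∞ (act Φ w) := by
  induction w with
  | nil => exact contDiff_id
  | cons p w ih => exact ((Φ p.1).smooth_apply p.2).comp ih

/-- The word acting as the inverse of a word. -/
def invWord (w : List (ι × ℝ)) : List (ι × ℝ) := (w.map fun p => (p.1, -p.2)).reverse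

lemma act_invWord_act (w : List (ι × ℝ)) (x : E) : act Φ (invWord w) (act Φ w x) = x := by
  induction w with
  | nil => rfl
  | cons p w ih =>
    simp only [invWord, List.map_cons, List.reverse_cons, act_append, act_cons, act_nil,
      SmoothFlow.neg_apply]
    exact ih

lemma invWord_invWord (w : List (ι × ℝ)) : invWord (invWord w) = w := by
  simp [invWord, List.map_reverse, Function.comp_def]

lemma act_act_invWord (w : List (ι × ℝ)) (x : E) : act Φ w (act Φ (invWord w) x) = x := by
  have := act_invWord_act Φ (invWord w) x
  rwa [invWord_invWord] at this

/-- Two points are in the same orbit of the family of flows. -/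
def SameOrbit (x y : E) : Prop := ∃ w, act Φ w x = y

variable {Φ}

lemma SameOrbit.refl (x : E) : SameOrbit Φ x x := ⟨[], rfl⟩

lemma SameOrbit.symm {x y : E} : SameOrbit Φ x y → SameOrbit Φ y x := by
  rintro ⟨w, rfl⟩
  exact ⟨invWord w, act_invWord_act Φ w x⟩

lemma SameOrbit.trans {x y z : E} : SameOrbit Φ x y → SameOrbit Φ y z → SameOrbit Φ x z := by
  rintro ⟨w, rfl⟩ ⟨w', rfl⟩
  exact ⟨w' ++ w, act_append Φ w' w x⟩

lemma sameOrbit_act (w : List (ι × ℝ)) (x : E) : SameOrbit Φ x (act Φ w x) := ⟨w, rfl⟩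

variable (Φ)

/-- The smallest distribution that contains the generators and is invariant under the flows. -/
noncomputable def orbitTangent (p : E) : Submodule ℝ E :=
  Submodule.span ℝ {v | ∃ w a q, act Φ w q = p ∧ v = fderiv ℝ (act Φ w) q ((Φ a).field q)}

lemma field_mem_orbitTangent (a : ι) (p : E) : (Φ a).field p ∈ orbitTangent Φ p := by
  refine Submodule.subset_span ⟨[], a, p, rfl, ?_⟩
  have : act Φ [] = id := rfl
  rw [this, fderiv_id]
  rfl

variable {Φ}

lemma differentiableAt_act (w : List (ι × ℝ)) (x : E) : DifferentiableAt ℝ (act Φ w) x :=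
  (contDiff_act Φ w).differentiable (by simp) x

lemma fderiv_act_append (w w' : List (ι × ℝ)) (x : E) :
    fderiv ℝ (act Φ (w ++ w')) x = fderiv ℝ (act Φ w) (act Φ w' x) ∘L fderiv ℝ (act Φ w') x := by
  have : act Φ (w ++ w') = act Φ w ∘ act Φ w' := funext fun x => act_append Φ w w' x
  rw [this, fderiv_comp _ (differentiableAt_act _ _) (differentiableAt_act _ _)]

lemma fderiv_act_mem_orbitTangent (w : List (ι × ℝ)) {p v : E} (hv : v ∈ orbitTangent Φ p) :
    fderiv ℝ (act Φ w) p v ∈ orbitTangent Φ (act Φ w p) := by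
  suffices h : orbitTangent Φ p ≤
      (orbitTangent Φ (act Φ w p)).comap (fderiv ℝ (act Φ w) p : E →ₗ[ℝ] E) from h hv
  refine Submodule.span_le.2 ?_
  rintro v ⟨w', a, q, rfl, rfl⟩
  refine Submodule.subset_span ⟨w ++ w', a, q, act_append Φ w w' q, ?_⟩
  rw [fderiv_act_append]
  rfl

lemma fderiv_act_injective (w : List (ι × ℝ)) (p : E) :
    Function.Injective (fderiv ℝ (act Φ w) p) := by
  have h : fderiv ℝ (act Φ (invWord w)) (act Φ w p) ∘L fderiv ℝ (act Φ w) p = .id ℝ E := by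
    rw [← fderiv_comp _ (differentiableAt_act _ _) (differentiableAt_act _ _)]
    have : act Φ (invWord w) ∘ act Φ w = id := funext fun x => act_invWord_act Φ w x
    rw [this, fderiv_id]
  exact Function.LeftInverse.injective (g := fderiv ℝ (act Φ (invWord w)) (act Φ w p))
    fun v => DFunLike.congr_fun h v

/-- The differential of a word is injective and carries the distribution at `p` into the one at `q`.
-/
lemma SameOrbit.finrank_le [FiniteDimensional ℝ E] {p q : E} (h : SameOrbit Φ p q) :
    Module.finrank ℝ (orbitTangent Φ p) ≤ Module.finrank ℝ (orbitTangent Φ q) := by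
  obtain ⟨w, rfl⟩ := h
  rw [← LinearMap.finrank_range_of_inj (f := (fderiv ℝ (act Φ w) p : E →ₗ[ℝ] E).domRestrict
    (orbitTangent Φ p)) ((fderiv_act_injective w p).comp Subtype.val_injective)]
  refine Submodule.finrank_mono ?_
  rintro _ ⟨v, rfl⟩
  exact fderiv_act_mem_orbitTangent w v.2

lemma SameOrbit.finrank_eq [FiniteDimensional ℝ E] {p q : E} (h : SameOrbit Φ p q) :
    Module.finrank ℝ (orbitTangent Φ p) = Module.finrank ℝ (orbitTangent Φ q) :=
  le_antisymm h.finrank_le h.symm.finrank_le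

variable {V : Type*} [NormedAddCommGroup V] [NormedSpace ℝ V]

/-- Evaluation of a word whose times depend on a parameter. -/
def evalWord (l : List (ι × (V → ℝ))) (z : V) : List (ι × ℝ) := l.map fun p => (p.1, p.2 z)

lemma contDiff_act_evalWord {l : List (ι × (V → ℝ))} (hl : ∀ p ∈ l, ContDiff ℝ ∞ p.2)
    {g : V → E} (hg : ContDiff ℝ ∞ g) : ContDiff ℝ ∞ fun z => act Φ (evalWord l z) (g z) := by
  induction l with
  | nil => exact hg
  | cons p l ih =>
    exact (Φ p.1).smooth.comp ((hl p (by simp)).prodMk (ih fun q hq => hl q (by simp [hq])))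

/-- Differentiating the last flow applied gives two terms: a multiple of its generator, coming from
the varying time, and the pushforward of the derivative of the remaining word. Both lie in the
invariant distribution. -/
lemma fderiv_act_evalWord_mem {l : List (ι × (V → ℝ))} (hl : ∀ p ∈ l, ContDiff ℝ ∞ p.2)
    {g : V → E} (hg : ContDiff ℝ ∞ g) {z v : V}
    (hv : fderiv ℝ g z v ∈ orbitTangent Φ (g z)) :
    fderiv ℝ (fun z => act Φ (evalWord l z) (g z)) z v ∈
      orbitTangent Φ (act Φ (evalWord l z) (g z)) := by
  induction l with
  | nil => exact hv
  | cons p l ih =>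
    have hl' : ∀ q ∈ l, ContDiff ℝ ∞ q.2 := fun q hq => hl q (by simp [hq])
    set h : V → E := fun z => act Φ (evalWord l z) (g z) with hh
    have hd : HasFDerivAt h _ z :=
      ((contDiff_act_evalWord (Φ := Φ) hl' hg).differentiable (by simp) z).hasFDerivAt
    have hp : HasFDerivAt p.2 _ z :=
      ((hl p (by simp)).differentiable (by simp) z).hasFDerivAt
    have hΦ : HasFDerivAt (fun q : ℝ × E => (Φ p.1).toFun q.1 q.2) _ (p.2 z, h z) :=
      ((Φ p.1).smooth.differentiable (by simp) _).hasFDerivAt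
    have hc := (HasFDerivAt.comp (f := fun z => (p.2 z, h z)) z hΦ (hp.prodMk hd)).fderiv
    have hfun : (fun z => act Φ (evalWord (p :: l) z) (g z)) =
      (fun q : ℝ × E => (Φ p.1).toFun q.1 q.2) ∘ fun z => (p.2 z, h z) := rfl
    rw [hfun, hc]
    simp only [ContinuousLinearMap.comp_apply, ContinuousLinearMap.prod_apply,
      SmoothFlow.fderiv_uncurry]
    refine Submodule.add_mem _ (Submodule.smul_mem _ _ (field_mem_orbitTangent Φ p.1 _)) ?_
    exact fderiv_act_mem_orbitTangent (Φ := Φ) [(p.1, p.2 z)] (ih hl')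

lemma act_flatMap_eq_self {κ : Type*} {f : κ → List (ι × ℝ)} {L : List κ}
    (h : ∀ j ∈ L, ∀ x, act Φ (f j) x = x) (x : E) : act Φ (L.flatMap f) x = x := by
  induction L with
  | nil => rfl
  | cons j L ih =>
    rw [List.flatMap_cons, act_append, ih fun i hi => h i (by simp [hi]), h j (by simp)]

lemma act_flatMap_eq_single {κ : Type*} {f : κ → List (ι × ℝ)} {L : List κ} (hL : L.Nodup)
    {i : κ} (hi : i ∈ L) (h : ∀ j ∈ L, j ≠ i → ∀ x, act Φ (f j) x = x) (x : E) :
    act Φ (L.flatMap f) x = act Φ (f i) x := by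
  induction L with
  | nil => simp at hi
  | cons j L ih =>
    rw [List.nodup_cons] at hL
    rw [List.flatMap_cons, act_append]
    by_cases hji : j = i
    · subst hji
      rw [act_flatMap_eq_self fun k hk => h k (by simp [hk]) (by rintro rfl; exact hL.1 hk)]
    · rw [ih hL.2 (by simpa [Ne.symm hji] using hi) fun k hk => h k (by simp [hk]),
        h j (by simp) hji]

end Orbit

/-! ### Charts straightening an orbit -/

lemma exists_chart_on_ball {E : Type*} [NormedAddCommGroup E] [NormedSpace ℝ E] [CompleteSpace E]
    {f : E → E} (hf : ContDiff ℝ ∞ f) (L : E ≃L[ℝ] E) (hL : HasFDerivAt f (L : E →L[ℝ] E) 0)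
    {U : Set E} (hU : U ∈ 𝓝 (f 0)) :
    ∃ ε > 0, ∃ e : OpenPartialHomeomorph E E, e.source = Metric.ball 0 ε ∧ (e : E → E) = f ∧
      e.target ⊆ U ∧ ContDiffOn ℝ ∞ e.symm e.target := by
  let e₀ := hf.contDiffAt.toOpenPartialHomeomorph f hL (by simp)
  have h1 : e₀.source ∈ 𝓝 (0 : E) :=
    e₀.open_source.mem_nhds (hf.contDiffAt.mem_toOpenPartialHomeomorph_source hL (by simp))
  have h2 : fderiv ℝ f ⁻¹' range ((↑) : (E ≃L[ℝ] E) → E →L[ℝ] E) ∈ 𝓝 (0 : E) := by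
    refine (hf.continuous_fderiv (by simp)).continuousAt.preimage_mem_nhds ?_
    rw [hL.fderiv]
    exact L.nhds
  have h3 : f ⁻¹' U ∈ 𝓝 (0 : E) := hf.continuous.continuousAt.preimage_mem_nhds hU
  -- Invertibility of the derivative on the whole ball makes the inverse smooth on the whole target.
  obtain ⟨ε, hε, hball⟩ := Metric.mem_nhds_iff.1 (Filter.inter_mem (Filter.inter_mem h1 h2) h3)
  let e := e₀.restrOpen (Metric.ball 0 ε) Metric.isOpen_ball
  have hsrc : e.source = Metric.ball 0 ε :=
    inter_eq_right.2 fun z hz => (hball hz).1.1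
  refine ⟨ε, hε, e, hsrc, rfl, fun y hy => ?_, fun y hy => ?_⟩
  · have := (hball (hsrc ▸ e.map_target hy)).2
    rwa [mem_preimage, show f (e.symm y) = y from e.right_inv hy] at this
  · obtain ⟨L', hL'⟩ := (hball (hsrc ▸ e.map_target hy)).1.2
    refine (e.contDiffAt_symm hy (f₀' := L') ?_ hf.contDiffAt).contDiffWithinAt
    rw [hL']
    exact (hf.differentiable (by simp) _).hasFDerivAt

lemma exists_basis_extending {n r : ℕ} (h : r ≤ n) {v : Fin r → EuclideanSpace ℝ (Fin n)}
    (hv : LinearIndependent ℝ v) :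
    ∃ b : Module.Basis (Fin n) ℝ (EuclideanSpace ℝ (Fin n)), ∀ j, b (Fin.castLE h j) = v j := by
  let b := Module.Basis.sumExtend hv
  have : Finite (Fin r ⊕ Module.Basis.sumExtendIndex hv) := Module.Finite.finite_basis b
  have : Finite (Module.Basis.sumExtendIndex hv) := Finite.sum_right (Fin r)
  have := Fintype.ofFinite (Module.Basis.sumExtendIndex hv)
  have hcard : r + Fintype.card (Module.Basis.sumExtendIndex hv) = n := by
    have := Module.finrank_eq_card_basis b
    simpa using this.symm
  let e : Fin r ⊕ Module.Basis.sumExtendIndex hv ≃ Fin n :=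
    ((Equiv.refl _).sumCongr (Fintype.equivFin _)).trans (finSumFinEquiv.trans (finCongr hcard))
  refine ⟨b.reindex e, fun j => ?_⟩
  have : e (Sum.inl j) = Fin.castLE h j := by
    ext
    simp [e]
  rw [← this, Module.Basis.reindex_apply, Equiv.symm_apply_apply]
  simp only [b, Module.Basis.sumExtend, Module.Basis.reindex_apply,
    Module.Basis.extend_apply_self]
  rfl

section OrbitChart

variable {n : ℕ} {ι : Type*} {Φ : ι → SmoothFlow (EuclideanSpace ℝ (Fin n))}

local notation "𝔼" => EuclideanSpace ℝ (Fin n)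

/-- The word `w (a, τ) w⁻¹`, with `τ` depending on a parameter. -/
def conjWord {V : Type*} (w : List (ι × ℝ)) (a : ι) (τ : V → ℝ) : List (ι × (V → ℝ)) :=
  (w.map fun p => (p.1, fun _ => p.2)) ++ (a, τ) :: ((invWord w).map fun p => (p.1, fun _ => p.2))

lemma contDiff_of_mem_conjWord {V : Type*} [NormedAddCommGroup V] [NormedSpace ℝ V]
    {w : List (ι × ℝ)} {a : ι} {τ : V → ℝ} (hτ : ContDiff ℝ ∞ τ) :
    ∀ p ∈ conjWord w a τ, ContDiff ℝ ∞ p.2 := by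
  intro p hp
  simp only [conjWord, List.mem_append, List.mem_map, List.mem_cons] at hp
  rcases hp with ⟨q, -, rfl⟩ | rfl | ⟨q, -, rfl⟩
  · exact contDiff_const
  · exact hτ
  · exact contDiff_const

lemma evalWord_conjWord {V : Type*} (w : List (ι × ℝ)) (a : ι) (τ : V → ℝ) (z : V) :
    evalWord (conjWord w a τ) z = w ++ (a, τ z) :: invWord w := by
  simp [evalWord, conjWord, Function.comp_def]

lemma act_conj {E : Type*} [NormedAddCommGroup E] [NormedSpace ℝ E] (Φ : ι → SmoothFlow E)
    (w : List (ι × ℝ)) (a : ι) (t : ℝ) (x : E) :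
    act Φ (w ++ (a, t) :: invWord w) x = act Φ w ((Φ a).toFun t (act Φ (invWord w) x)) := by
  rw [act_append]
  rfl

/-- A basis can be chosen among the spanning vectors themselves. Each of these is the velocity at
time `0` of a conjugated flow through `p`, so it can serve as a coordinate direction. -/
lemma exists_frame (p : 𝔼) : ∃ (r : ℕ) (w : Fin r → List (ι × ℝ)) (a : Fin r → ι),
    r = Module.finrank ℝ (orbitTangent Φ p) ∧ LinearIndependent ℝ fun j =>
      fderiv ℝ (act Φ (w j)) (act Φ (invWord (w j)) p)
        ((Φ (a j)).field (act Φ (invWord (w j)) p)) := by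
  obtain ⟨f, hf, -, hli⟩ := Submodule.exists_fun_fin_finrank_span_eq ℝ
    {v | ∃ w a q, act Φ w q = p ∧ v = fderiv ℝ (act Φ w) q ((Φ a).field q)}
  choose w a q hq hv using hf
  have hq' : ∀ j, q j = act Φ (invWord (w j)) p := fun j => by rw [← hq j, act_invWord_act]
  have hf' : f = fun j => fderiv ℝ (act Φ (w j)) (act Φ (invWord (w j)) p)
      ((Φ (a j)).field (act Φ (invWord (w j)) p)) := funext fun j => by rw [hv, hq']
  exact ⟨_, w, a, rfl, hf' ▸ hli⟩

/-- Near every point there is a chart that straightens the orbit through the point, and that is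
adapted to the other orbits. -/
theorem exists_orbit_chart (p : 𝔼) {U : Set 𝔼} (hU : U ∈ 𝓝 p) :
    ∃ (r : ℕ) (e : OpenPartialHomeomorph 𝔼 𝔼), r ≤ n ∧ (∃ ε > 0, e.source = Metric.ball 0 ε) ∧
      e 0 = p ∧ e.target ⊆ U ∧ ContDiff ℝ ∞ e ∧ ContDiffOn ℝ ∞ e.symm e.target ∧
      (∀ z z', (∀ i : Fin n, r ≤ (i : ℕ) → z i = z' i) → SameOrbit Φ (e z) (e z')) ∧
      ∀ z ∈ e.source, SameOrbit Φ p (e z) → ∀ v ∈ orbitTangent Φ (e z),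
        fderiv ℝ e.symm (e z) v ∈ coordSubspace n r := by
  obtain ⟨r, w, a, hr, hli⟩ := exists_frame (Φ := Φ) p
  have hrn : r ≤ n := by
    rw [hr]
    simpa using Submodule.finrank_le (orbitTangent Φ p)
  obtain ⟨b, hb⟩ := exists_basis_extending hrn hli
  -- The first `r` coordinates are the times of the conjugated flows; the others, in `g`,
  -- parametrize an affine transversal. Thus points with equal last coordinates come from the same
  -- `g z` by words.
  let f : Fin r → List (ι × (𝔼 → ℝ)) := fun j =>
    conjWord (w j) (a j) fun z => z (Fin.castLE hrn j)
  let l : List (ι × (𝔼 → ℝ)) := (List.finRange r).flatMap f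
  have hl : ∀ q ∈ l, ContDiff ℝ ∞ q.2 := by
    intro q hq
    obtain ⟨j, -, hj⟩ := List.mem_flatMap.1 hq
    have hτ : ContDiff ℝ ∞ fun z : 𝔼 => z (Fin.castLE hrn j) := by fun_prop
    exact contDiff_of_mem_conjWord hτ q hj
  let g : 𝔼 → 𝔼 := fun z => p + ∑ j : Fin n, if r ≤ (j : ℕ) then z j • b j else 0
  have hg : ContDiff ℝ ∞ g := by
    refine contDiff_const.add (ContDiff.sum fun j _ => ?_)
    split_ifs
    · have hj : ContDiff ℝ ∞ fun z : 𝔼 => z j := by fun_prop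
      exact hj.smul contDiff_const
    · exact contDiff_const
  let ψ : 𝔼 → 𝔼 := fun z => act Φ (evalWord l z) (g z)
  have hψ : ContDiff ℝ ∞ ψ := contDiff_act_evalWord hl hg
  have hflat : ∀ z, evalWord l z = (List.finRange r).flatMap fun j => evalWord (f j) z := by
    intro z
    simp only [evalWord, l, List.map_flatMap]
  have hid : ∀ z j, z (Fin.castLE hrn j) = 0 → ∀ x, act Φ (evalWord (f j) z) x = x := by
    intro z j hz x
    rw [evalWord_conjWord, act_conj, hz, SmoothFlow.zero_apply, act_act_invWord]
  have hψ0 : ψ 0 = p := by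
    have h1 : g 0 = p := by simp [g]
    simp only [ψ, h1, hflat]
    exact act_flatMap_eq_self (fun j _ => hid 0 j (by simp)) p
  -- Along a coordinate axis at most one conjugated flow acts nontrivially, so the derivative of `ψ`
  -- at `0` maps the standard basis to `b`.
  have hline : ∀ i : Fin n, HasDerivAt (fun s : ℝ => ψ (EuclideanSpace.single i s)) (b i) 0 := by
    intro i
    by_cases hi : r ≤ (i : ℕ)
    · have h1 : ∀ s : ℝ, ψ (EuclideanSpace.single i s) = p + s • b i := by
        intro s
        have h2 : g (EuclideanSpace.single i s) = p + s • b i := by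
          simp only [g]
          congr 1
          rw [Finset.sum_eq_single i]
          · simp [hi]
          · intro j _ hj
            simp [hj]
          · simp
        simp only [ψ, h2, hflat]
        refine act_flatMap_eq_self (fun j _ => hid _ j ?_) _
        have : Fin.castLE hrn j ≠ i := by
          rintro rfl
          exact absurd hi (not_le.2 j.2)
        simp [this]
      simp only [h1]
      simpa using ((hasDerivAt_id (0 : ℝ)).smul_const (b i)).const_add p
    · obtain ⟨j, rfl⟩ : ∃ j, Fin.castLE hrn j = i := ⟨⟨i, not_le.1 hi⟩, rfl⟩
      have h1 : ∀ s : ℝ, ψ (EuclideanSpace.single (Fin.castLE hrn j) s) =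
          act Φ (w j) ((Φ (a j)).toFun s (act Φ (invWord (w j)) p)) := by
        intro s
        have h2 : g (EuclideanSpace.single (Fin.castLE hrn j) s) = p := by
          simp only [g]
          rw [Finset.sum_eq_zero, add_zero]
          intro k _
          split_ifs with hk
          · have : k ≠ Fin.castLE hrn j := by
              rintro rfl
              exact hi hk
            simp [this]
          · rfl
        simp only [ψ, h2, hflat]
        rw [act_flatMap_eq_single (List.nodup_finRange r) (List.mem_finRange j), evalWord_conjWord,
          act_conj]
        · simp
        · intro k _ hk
          refine hid _ k ?_
          have : Fin.castLE hrn k ≠ Fin.castLE hrn j := by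
            simpa using hk
          simp [this]
      simp only [h1, hb]
      have h3 : HasFDerivAt (act Φ (w j)) _ ((Φ (a j)).toFun 0 (act Φ (invWord (w j)) p)) :=
        (differentiableAt_act (Φ := Φ) (w j) _).hasFDerivAt
      have h4 := h3.comp_hasDerivAt (0 : ℝ) ((Φ (a j)).hasDerivAt 0 (act Φ (invWord (w j)) p))
      rw [SmoothFlow.zero_apply] at h4
      exact h4
  let L : 𝔼 ≃L[ℝ] 𝔼 := ((EuclideanSpace.basisFun (Fin n) ℝ).toBasis.equiv b
    (Equiv.refl _)).toContinuousLinearEquiv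
  have hL : HasFDerivAt ψ (L : 𝔼 →L[ℝ] 𝔼) 0 := by
    have h1 : HasFDerivAt ψ (fderiv ℝ ψ 0) 0 := (hψ.differentiable (by simp) 0).hasFDerivAt
    have h2 : fderiv ℝ ψ 0 = (L : 𝔼 →L[ℝ] 𝔼) := by
      refine ContinuousLinearMap.coe_injective
        ((EuclideanSpace.basisFun (Fin n) ℝ).toBasis.ext fun i => ?_)
      have h3 : HasDerivAt (fun s : ℝ => EuclideanSpace.single i s)
          (EuclideanSpace.single i (1 : ℝ)) 0 := by
        have : (fun s : ℝ => EuclideanSpace.single i s) =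
            fun s : ℝ => s • EuclideanSpace.single i (1 : ℝ) := by
          ext s j
          simp
        rw [this]
        simpa using (hasDerivAt_id (0 : ℝ)).smul_const (EuclideanSpace.single i (1 : ℝ))
      have h4 : HasFDerivAt ψ (fderiv ℝ ψ 0) (EuclideanSpace.single i (0 : ℝ)) := by
        have h0 : EuclideanSpace.single i (0 : ℝ) = 0 := by
          ext j
          simp
        rwa [h0]
      have h5 := (h4.comp_hasDerivAt (0 : ℝ) h3).unique (hline i)
      have h6 : L ((EuclideanSpace.basisFun (Fin n) ℝ).toBasis i) = b i := by
        simp only [L, LinearEquiv.coe_toContinuousLinearEquiv']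
        rw [Module.Basis.equiv_apply]
        rfl
      simp only [ContinuousLinearMap.coe_coe, ContinuousLinearEquiv.coe_coe, h6]
      simpa using h5
    rwa [h2] at h1
  obtain ⟨ε, hε, e, hsrc, hcoe, htgt, hsymm⟩ := exists_chart_on_ball hψ L hL (hψ0.symm ▸ hU)
  refine ⟨r, e, hrn, ⟨ε, hε, hsrc⟩, hcoe ▸ hψ0, htgt, hcoe ▸ hψ, hsymm, ?_, ?_⟩
  · intro z z' hzz
    rw [hcoe]
    have h1 : g z = g z' := by
      simp only [g]
      congr 1
      refine Finset.sum_congr rfl fun j _ => ?_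
      split_ifs with hj
      · rw [hzz j hj]
      · rfl
    refine (sameOrbit_act (Φ := Φ) (evalWord l z) (g z)).symm.trans ?_
    rw [h1]
    exact sameOrbit_act (Φ := Φ) (evalWord l z') (g z')
  -- The images of the first `r` coordinate vectors lie in the distribution at `e z`, since `g`
  -- ignores these coordinates. They are independent, and the rank is `r` everywhere on the orbit of
  -- `p`, so they span.
  · intro z hz hO v hv
    have hinv : ∀ u, fderiv ℝ e.symm (e z) (fderiv ℝ e z u) = u := by
      intro u
      have h1 : HasFDerivAt e.symm (fderiv ℝ e.symm (e z)) (e z) :=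
        ((hsymm.contDiffAt (e.open_target.mem_nhds (e.map_source hz))).differentiableAt
          (by simp)).hasFDerivAt
      have h2 : HasFDerivAt e (fderiv ℝ e z) z := by
        rw [hcoe]
        exact (hψ.differentiable (by simp) z).hasFDerivAt
      have h3 : HasFDerivAt (fun y => e.symm (e y)) (.id ℝ 𝔼) z :=
        (hasFDerivAt_id z).congr_of_eventuallyEq (e.eventually_left_inverse hz)
      exact DFunLike.congr_fun ((HasFDerivAt.comp z h1 h2).unique h3) u
    let u : Fin r → 𝔼 := fun j => EuclideanSpace.single (Fin.castLE hrn j) (1 : ℝ)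
    have hu : ∀ j, fderiv ℝ e z (u j) ∈ orbitTangent Φ (e z) := by
      intro j
      rw [hcoe]
      refine fderiv_act_evalWord_mem hl hg ?_
      have : fderiv ℝ g z (u j) = 0 := by
        have hc : ∀ s : ℝ, g (z + s • u j) = g z := by
          intro s
          simp only [g]
          congr 1
          refine Finset.sum_congr rfl fun k _ => ?_
          split_ifs with hk
          · have : k ≠ Fin.castLE hrn j := by
              rintro rfl
              exact absurd hk (not_le.2 j.2)
            simp [u, this]
          · rfl
        have hgd : HasFDerivAt g (fderiv ℝ g z) z := (hg.differentiable (by simp) z).hasFDerivAt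
        have h1 := hgd.hasLineDerivAt (u j)
        simp only [HasLineDerivAt, hc] at h1
        exact h1.unique (hasDerivAt_const _ _)
      rw [this]
      exact Submodule.zero_mem _
    have hli' : LinearIndependent ℝ fun j => fderiv ℝ e z (u j) := by
      have h1 : LinearIndependent ℝ u := by
        have := (EuclideanSpace.basisFun (Fin n) ℝ).toBasis.linearIndependent.comp
          (Fin.castLE hrn) (Fin.castLE_injective hrn)
        have h2 : u = (EuclideanSpace.basisFun (Fin n) ℝ).toBasis ∘ Fin.castLE hrn := by
          funext j
          simp [u]
        rwa [h2]
      exact h1.map' (fderiv ℝ e z : 𝔼 →ₗ[ℝ] 𝔼)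
        (LinearMap.ker_eq_bot.2 (Function.LeftInverse.injective hinv))
    have hspan : Submodule.span ℝ (range fun j => fderiv ℝ e z (u j)) = orbitTangent Φ (e z) := by
      refine Submodule.eq_of_le_of_finrank_eq (Submodule.span_le.2 ?_) ?_
      · rintro _ ⟨j, rfl⟩
        exact hu j
      · rw [finrank_span_eq_card hli', ← hO.finrank_eq, ← hr, Fintype.card_fin]
    rw [← hspan] at hv
    suffices h : Submodule.span ℝ (range fun j => fderiv ℝ e z (u j)) ≤
        (coordSubspace n r).comap (fderiv ℝ e.symm (e z) : 𝔼 →ₗ[ℝ] 𝔼) from h hv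
    refine Submodule.span_le.2 ?_
    rintro _ ⟨j, rfl⟩
    simp only [SetLike.mem_coe, Submodule.mem_comap, ContinuousLinearMap.coe_coe, hinv]
    intro i hi
    have : i ≠ Fin.castLE hrn j := by
      rintro rfl
      exact absurd hi (not_le.2 j.2)
    simp [u, this]

end OrbitChart

/-! ### Orbits are initial submanifolds -/

lemma countable_image_of_hasFDerivAt_zero {V : Type*} [NormedAddCommGroup V] [NormedSpace ℝ V]
    [SecondCountableTopology V] {Ω : Set V} (hΩ : IsOpen Ω) {f : V → ℝ}
    (hf : ∀ z ∈ Ω, HasFDerivAt f (0 : V →L[ℝ] ℝ) z) : (f '' Ω).Countable := by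
  have h1 : ∀ z ∈ Ω, {y | f y = f z} ∈ 𝓝[Ω] z := by
    intro z hz
    obtain ⟨ε, hε, hball⟩ := Metric.isOpen_iff.1 hΩ z hz
    refine mem_nhdsWithin_of_mem_nhds (Filter.mem_of_superset (Metric.ball_mem_nhds z hε) ?_)
    intro y hy
    refine (convex_ball z ε).is_const_of_fderivWithin_eq_zero (𝕜 := ℝ)
      (fun w hw => (hf w (hball hw)).differentiableAt.differentiableWithinAt) (fun w hw => ?_) hy
      (Metric.mem_ball_self hε)
    rw [fderivWithin_of_isOpen Metric.isOpen_ball hw]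
    exact (hf w (hball hw)).fderiv
  -- `f` is locally constant on `Ω`, and by the Lindelöf property countably many of its level sets
  -- cover `Ω`.
  obtain ⟨t, -, ht, hcover⟩ := TopologicalSpace.countable_cover_nhdsWithin h1
  refine (ht.image f).mono ?_
  rintro _ ⟨y, hy, rfl⟩
  obtain ⟨z, hz, hyz⟩ := mem_iUnion₂.1 (hcover hy)
  exact ⟨z, hz, hyz.symm⟩

lemma eq_of_countable_image {f : ℝ → ℝ} {a b : ℝ} (hf : ContinuousOn f (Icc a b))
    (hc : (f '' Icc a b).Countable) {s t : ℝ} (hs : s ∈ Icc a b) (ht : t ∈ Icc a b) :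
    f s = f t :=
  hc.isTotallyDisconnected _ subset_rfl (isPreconnected_Icc.image f hf) ⟨s, hs, rfl⟩ ⟨t, ht, rfl⟩

section

variable {n : ℕ} {ι : Type*} {Φ : ι → SmoothFlow (EuclideanSpace ℝ (Fin n))}

local notation "𝔼" => EuclideanSpace ℝ (Fin n)

/-- A word is a finite sequence of indices, of which there are countably many, together with real
times. For fixed indices the point depends smoothly on the times with derivative in the
distribution, so every transverse coordinate has zero derivative. -/
lemma countable_transverse_values [Countable ι] {x : 𝔼} {r : ℕ}
    {e : OpenPartialHomeomorph 𝔼 𝔼} (hsymm : ContDiffOn ℝ ∞ e.symm e.target)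
    (hD : ∀ z ∈ e.source, SameOrbit Φ x (e z) → ∀ v ∈ orbitTangent Φ (e z),
      fderiv ℝ e.symm (e z) v ∈ coordSubspace n r) {i : Fin n} (hi : r ≤ (i : ℕ)) :
    ((fun y => e.symm y i) '' {y ∈ e.target | SameOrbit Φ x y}).Countable := by
  let l : ∀ N : ℕ, (Fin N → ι) → List (ι × ((Fin N → ℝ) → ℝ)) := fun N a =>
    List.ofFn fun j => (a j, fun z => z j)
  have hl : ∀ N a, ∀ q ∈ l N a, ContDiff ℝ ∞ q.2 := by
    intro N a q hq
    obtain ⟨j, rfl⟩ := (List.mem_ofFn' _ _).1 hq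
    exact contDiff_apply ℝ ℝ j
  let θ : ∀ N : ℕ, (Fin N → ι) → (Fin N → ℝ) → 𝔼 := fun N a z => act Φ (evalWord (l N a) z) x
  have hθ : ∀ N a, ContDiff ℝ ∞ (θ N a) := fun N a =>
    contDiff_act_evalWord (hl N a) contDiff_const
  have hθD : ∀ N a z v, fderiv ℝ (θ N a) z v ∈ orbitTangent Φ (θ N a z) := fun N a z v =>
    fderiv_act_evalWord_mem (hl N a) contDiff_const (by simp)
  have hcov : ∀ y, SameOrbit Φ x y → ∃ N a z, θ N a z = y := by
    rintro y ⟨w, rfl⟩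
    refine ⟨w.length, fun j => (w.get j).1, fun j => (w.get j).2, ?_⟩
    have : evalWord (l w.length fun j => (w.get j).1) (fun j => (w.get j).2) = w := by
      simp only [evalWord, l, List.map_ofFn, Function.comp_def, Prod.mk.eta]
      exact List.ofFn_get w
    simp only [θ, this]
  have hcount : ∀ N a, ((fun z => e.symm (θ N a z) i) '' (θ N a ⁻¹' e.target)).Countable := by
    intro N a
    refine countable_image_of_hasFDerivAt_zero (e.open_target.preimage (hθ N a).continuous)
      fun z hz => ?_
    have h1 : HasFDerivAt e.symm (fderiv ℝ e.symm (θ N a z)) (θ N a z) :=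
      ((hsymm.contDiffAt (e.open_target.mem_nhds hz)).differentiableAt (by simp)).hasFDerivAt
    have h2 : HasFDerivAt (θ N a) (fderiv ℝ (θ N a) z) z :=
      ((hθ N a).differentiable (by simp) z).hasFDerivAt
    have h3 := (EuclideanSpace.proj i : 𝔼 →L[ℝ] ℝ).hasFDerivAt.comp z
      (h1.comp z h2)
    have h4 := hD (e.symm (θ N a z)) (e.map_target hz)
    rw [e.right_inv hz] at h4
    have h5 : (EuclideanSpace.proj i : 𝔼 →L[ℝ] ℝ) ∘L
        (fderiv ℝ e.symm (θ N a z) ∘L fderiv ℝ (θ N a) z) = 0 := by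
      ext1 v
      exact h4 (sameOrbit_act (Φ := Φ) _ x) _ (hθD N a z v) i hi
    rw [h5] at h3
    exact h3
  have : (⋃ q : Σ N : ℕ, Fin N → ι,
      (fun z => e.symm (θ q.1 q.2 z) i) '' (θ q.1 q.2 ⁻¹' e.target)).Countable :=
    countable_iUnion fun q => hcount q.1 q.2
  refine this.mono ?_
  rintro _ ⟨y, ⟨hy, hxy⟩, rfl⟩
  obtain ⟨N, a, z, rfl⟩ := hcov y hxy
  exact mem_iUnion.2 ⟨⟨N, a⟩, z, hy, rfl⟩

/-- The orbits of a countable family of smooth flows are initial submanifolds. -/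
theorem isInitialSubmanifold_orbit [Countable ι] {M : Set 𝔼} (hM : IsOpen M) (x : 𝔼)
    (hxM : {y | SameOrbit Φ x y} ⊆ M) : IsInitialSubmanifold M {y | SameOrbit Φ x y} := by
  refine ⟨hxM, fun p hp => ?_⟩
  obtain ⟨r, e, hr, ⟨ε, hε, hsrc⟩, he0, htgt, hsmooth, hsymm, hsame, hD⟩ :=
    exists_orbit_chart (Φ := Φ) p (hM.mem_nhds (hxM hp))
  have h0 : (0 : 𝔼) ∈ e.source := hsrc ▸ Metric.mem_ball_self hε
  have hpt : p ∈ e.target := he0 ▸ e.map_source h0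
  have hp0 : e.symm p = 0 := he0 ▸ e.left_inv h0
  refine ⟨e.symm, r, htgt, hsymm, by simpa using hsmooth.contDiffOn, hpt, hp0, hr, ?_⟩
  ext z
  constructor
  · rintro ⟨y, ⟨c, hc, hmaps, hc0, rfl⟩, rfl⟩
    have h1 : (1 : ℝ) ∈ Icc (0 : ℝ) 1 := by simp
    have h0' : (0 : ℝ) ∈ Icc (0 : ℝ) 1 := by simp
    refine ⟨e.map_target (hmaps h1).1, fun i hi => ?_⟩
    have hcont : ContinuousOn (fun s => e.symm (c s) i) (Icc 0 1) := by
      have : ContinuousOn (fun s => e.symm (c s)) (Icc 0 1) :=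
        hsymm.continuousOn.comp hc.continuousOn fun s hs => (hmaps hs).1
      exact (EuclideanSpace.proj i : 𝔼 →L[ℝ] ℝ).continuous.comp_continuousOn
        this
    have hD' : ∀ z ∈ e.source, SameOrbit Φ x (e z) → ∀ v ∈ orbitTangent Φ (e z),
        fderiv ℝ e.symm (e z) v ∈ coordSubspace n r := fun z hz hxz =>
      hD z hz ((SameOrbit.symm hp).trans hxz)
    have hcount := countable_transverse_values hsymm hD' hi
    have := eq_of_countable_image hcont (hcount.mono ?_) h1 h0'
    · simp only at this
      rw [this, hc0, hp0]
      rfl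
    · rintro _ ⟨s, hs, rfl⟩
      exact ⟨c s, hmaps hs, rfl⟩
  · rintro ⟨hz, hzr⟩
    have hz' : z ∈ e.source := hz
    -- The radial segment stays in the ball and in the central slice, hence its image stays in the
    -- orbit.
    refine ⟨e z, ⟨fun s => e (s • z), ?_, ?_, ?_, ?_⟩, e.left_inv hz'⟩
    · exact (hsmooth.comp (contDiff_id.smul contDiff_const)).contDiffOn
    · intro s hs
      refine ⟨e.map_source ?_, ?_⟩
      · rw [hsrc, mem_ball_zero_iff] at hz' ⊢
        rw [norm_smul, Real.norm_eq_abs, abs_of_nonneg hs.1]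
        exact (mul_le_of_le_one_left (norm_nonneg _) hs.2).trans_lt hz'
      · refine SameOrbit.trans hp (he0 ▸ hsame 0 (s • z) fun i hi => ?_)
        simp [hzr i hi]
    · simpa using he0
    · simp

/-- The flow line through `y` is a smooth curve in the orbit, so near time `0` any initial chart
maps it into the coordinate subspace; its velocity there has vanishing transverse coordinates. -/
lemma fderiv_field_mem_coordSubspace {M : Set 𝔼} {x y : 𝔼} (hy : SameOrbit Φ x y)
    {φ : OpenPartialHomeomorph 𝔼 𝔼} {r : ℕ}
    (hφ : IsInitialChart M {y | SameOrbit Φ x y} y φ r) (a : ι) :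
    fderiv ℝ φ y ((Φ a).field y) ∈ coordSubspace n r := by
  have hcont : Continuous fun t => (Φ a).toFun t y := ((Φ a).smooth_orbit y).continuous
  have hnhds : (fun t => (Φ a).toFun t y) ⁻¹' φ.source ∈ 𝓝 (0 : ℝ) := by
    refine hcont.continuousAt.preimage_mem_nhds (φ.open_source.mem_nhds ?_)
    rw [(Φ a).zero_apply]
    exact hφ.mem_source
  obtain ⟨δ, hδ, hball⟩ := Metric.mem_nhds_iff.1 hnhds
  have hmem : ∀ t ∈ Metric.ball (0 : ℝ) δ, φ ((Φ a).toFun t y) ∈ coordSubspace n r := by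
    intro t ht
    have h1 : (Φ a).toFun t y ∈ smoothComponent (φ.source ∩ {y | SameOrbit Φ x y}) y := by
      refine ⟨fun s => (Φ a).toFun (s * t) y, ?_, fun s hs => ⟨hball ?_, ?_⟩, ?_, ?_⟩
      · exact (((Φ a).smooth_orbit y).comp (contDiff_id.mul contDiff_const)).contDiffOn
      · rw [mem_ball_zero_iff] at ht ⊢
        rw [norm_mul, Real.norm_eq_abs s, abs_of_nonneg hs.1]
        exact (mul_le_of_le_one_left (norm_nonneg _) hs.2).trans_lt ht
      · exact hy.trans (sameOrbit_act (Φ := Φ) [(a, s * t)] y)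
      · simp [(Φ a).zero_apply]
      · simp
    have h2 := mem_image_of_mem φ h1
    rw [hφ.image_eq] at h2
    exact h2.2
  intro i hi
  have h1 : HasFDerivAt φ (fderiv ℝ φ y) ((Φ a).toFun 0 y) := by
    rw [(Φ a).zero_apply]
    exact ((hφ.smooth.contDiffAt (φ.open_source.mem_nhds hφ.mem_source)).differentiableAt
      (by simp)).hasFDerivAt
  have h2 := h1.comp_hasDerivAt (0 : ℝ) ((Φ a).hasDerivAt_zero y)
  have h3 := (EuclideanSpace.proj i : 𝔼 →L[ℝ] ℝ).hasFDerivAt.comp_hasDerivAt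
    (0 : ℝ) h2
  have h4 : HasDerivAt (fun _ : ℝ => (0 : ℝ)) (fderiv ℝ φ y ((Φ a).field y) i) 0 := by
    refine h3.congr_of_eventuallyEq ?_
    filter_upwards [Metric.ball_mem_nhds (0 : ℝ) hδ] with t ht
    exact (hmem t ht i hi).symm
  exact h4.unique (hasDerivAt_const _ _)

end

/-! ### Absolute continuity and a Grönwall argument -/

section Gronwall

lemma absolutelyContinuousOnInterval_lipschitzOnWith_comp {X Y : Type*} [PseudoMetricSpace X]
    [PseudoMetricSpace Y] {h : ℝ → X} {a b : ℝ} (hh : AbsolutelyContinuousOnInterval h a b)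
    {f : X → Y} {s : Set X} {K : NNReal} (hf : LipschitzOnWith K f s)
    (hs : MapsTo h (uIcc a b) s) : AbsolutelyContinuousOnInterval (fun t => f (h t)) a b := by
  rw [absolutelyContinuousOnInterval_iff] at hh ⊢
  intro ε hε
  -- The constant `K` may be zero, hence `K + 1`.
  obtain ⟨δ, hδ, H⟩ := hh (ε / (K + 1)) (by positivity)
  refine ⟨δ, hδ, fun E hE hsum => ?_⟩
  have h1 := H E hE hsum
  calc ∑ i ∈ Finset.range E.1, dist (f (h (E.2 i).1)) (f (h (E.2 i).2))
      ≤ ∑ i ∈ Finset.range E.1, K * dist (h (E.2 i).1) (h (E.2 i).2) :=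
        Finset.sum_le_sum fun i hi =>
          hf.dist_le_mul _ (hs (hE.1 i hi).1) _ (hs (hE.1 i hi).2)
    _ = K * ∑ i ∈ Finset.range E.1, dist (h (E.2 i).1) (h (E.2 i).2) := by rw [Finset.mul_sum]
    _ ≤ K * (ε / (K + 1)) := by gcongr
    _ < (K + 1) * (ε / (K + 1)) := by
        gcongr
        exact lt_add_one _
    _ = ε := by field_simp

variable {F : Type*} [NormedAddCommGroup F] [NormedSpace ℝ F]

/-- A short-time Grönwall lemma with integrable coefficient. -/
lemma eq_zero_of_norm_deriv_le_mul {h : ℝ → F} {g : ℝ → ℝ} {a b : ℝ}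
    (hac : AbsolutelyContinuousOnInterval h a b) (h0 : h a = 0) (hg0 : ∀ t, 0 ≤ g t)
    (hg : IntervalIntegrable g volume a b) (hsmall : |∫ t in a..b, g t| < 1)
    (hd : ∀ᵐ t, t ∈ uIcc a b → ∃ h', HasDerivAt h h' t ∧ ‖h'‖ ≤ g t * ‖h t‖) : h b = 0 := by
  -- At a maximum point `τ` of the norm, integration gives `‖h τ‖ ≤ |∫ g| * ‖h τ‖` with a factor
  -- below one. A norming functional `ℓ` at `h τ` reduces this to the scalar fundamental theorem of
  -- calculus.
  obtain ⟨τ, hτ, hmax⟩ := isCompact_uIcc.exists_isMaxOn nonempty_uIcc hac.continuousOn.norm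
  have hsub : uIcc a τ ⊆ uIcc a b := uIcc_subset_uIcc_left hτ
  have hsub' : uIoc a τ ⊆ uIoc a b := by
    rcases le_total a b with hab | hab
    · rw [uIcc_of_le hab] at hτ
      rw [uIoc_of_le hτ.1, uIoc_of_le hab]
      exact Ioc_subset_Ioc_right hτ.2
    · rw [uIcc_of_ge hab] at hτ
      rw [uIoc_of_ge hτ.2, uIoc_of_ge hab]
      exact Ioc_subset_Ioc_left hτ.1
  obtain ⟨ℓ, hℓ, hℓτ⟩ := exists_dual_vector'' ℝ (h τ)
  have hfac : AbsolutelyContinuousOnInterval (fun t => ℓ (h t)) a τ :=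
    absolutelyContinuousOnInterval_lipschitzOnWith_comp (f := fun y => ℓ y) (hac.mono hsub)
      (ℓ.lipschitz.lipschitzOnWith (s := univ)) (mapsTo_univ _ _)
  have hftc := hfac.integral_deriv_eq_sub
  simp only [h0, map_zero, sub_zero, hℓτ] at hftc
  have hgτ : IntervalIntegrable g volume a τ := hg.mono_set hsub
  have hle : ‖∫ t in a..τ, deriv (fun t => ℓ (h t)) t‖ ≤ |∫ t in a..τ, g t * ‖h τ‖| := by
    refine intervalIntegral.norm_integral_le_abs_of_norm_le ?_ (hgτ.mul_const _)
    rw [ae_restrict_iff' measurableSet_uIoc]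
    filter_upwards [hd] with t ht hmem
    have hmem' : t ∈ uIcc a b := hsub (uIoc_subset_uIcc hmem)
    obtain ⟨h', hh', hle⟩ := ht hmem'
    have h1 : HasDerivAt (fun t => ℓ (h t)) (ℓ h') t := ℓ.hasFDerivAt.comp_hasDerivAt t hh'
    rw [h1.deriv]
    calc ‖ℓ h'‖ ≤ 1 * ‖h'‖ := ℓ.le_of_opNorm_le hℓ h'
      _ = ‖h'‖ := one_mul _
      _ ≤ g t * ‖h t‖ := hle
      _ ≤ g t * ‖h τ‖ := mul_le_mul_of_nonneg_left (hmax hmem') (hg0 t)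
  rw [hftc, intervalIntegral.integral_mul_const, abs_mul, abs_norm] at hle
  have hmono : |∫ t in a..τ, g t| ≤ |∫ t in a..b, g t| :=
    intervalIntegral.abs_integral_mono_interval hsub' (Filter.Eventually.of_forall hg0) hg
  have hτ0 : ‖h τ‖ = 0 := by
    by_contra hne
    have hpos : 0 < ‖h τ‖ := lt_of_le_of_ne (norm_nonneg _) (Ne.symm hne)
    have h2 : ‖h τ‖ ≤ |∫ t in a..τ, g t| * ‖h τ‖ := by
      simpa using hle
    nlinarith
  exact norm_le_zero_iff.1 ((hmax right_mem_uIcc).trans hτ0.le)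

lemma eventually_abs_integral_lt_one {g : ℝ → ℝ} {a b t₀ : ℝ}
    (hg : IntervalIntegrable g volume a b) (ht₀ : t₀ ∈ Icc a b) :
    ∀ᶠ t in 𝓝[Icc a b] t₀, |∫ s in t₀..t, g s| < 1 := by
  have hab : a ≤ b := ht₀.1.trans ht₀.2
  have h1 := intervalIntegral.continuousOn_primitive_interval' hg (a := t₀)
    (by rwa [uIcc_of_le hab])
  rw [uIcc_of_le hab] at h1
  have h2 := (h1 t₀ ht₀).abs
  refine h2.eventually (gt_mem_nhds ?_)
  simp

lemma intervalIntegrable_sum_mul_abs {m : ℕ} (c : Fin m → ℝ) {u : Fin m → ℝ → ℝ} {a b : ℝ}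
    (hu : ∀ i, IntervalIntegrable (u i) volume a b) :
    IntervalIntegrable (fun t => ∑ i, c i * |u i t|) volume a b := by
  have h := IntervalIntegrable.sum (μ := volume) (a := a) (b := b) Finset.univ
    (f := fun i t => c i * |u i t|) fun i _ => (hu i).abs.const_mul _
  have h2 : (∑ i, fun t => c i * |u i t|) = fun t => ∑ i, c i * |u i t| := by
    funext t
    simp
  rwa [h2] at h

lemma eventually_uIcc_subset {a b t₀ : ℝ} (ht₀ : t₀ ∈ Icc a b) {N : Set ℝ}
    (hN : N ∈ 𝓝[Icc a b] t₀) : ∀ᶠ t in 𝓝[Icc a b] t₀, uIcc t₀ t ⊆ N ∩ Icc a b := by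
  obtain ⟨δ, hδ, hball⟩ := Metric.mem_nhdsWithin_iff.1 hN
  filter_upwards [mem_nhdsWithin_of_mem_nhds (Metric.ball_mem_nhds t₀ hδ), self_mem_nhdsWithin]
    with t ht htab
  have h1 : uIcc t₀ t ⊆ Icc a b := ordConnected_Icc.uIcc_subset ht₀ htab
  have h2 : uIcc t₀ t ⊆ Metric.ball t₀ δ :=
    (convex_ball t₀ δ).ordConnected.uIcc_subset (Metric.mem_ball_self hδ) ht
  exact fun s hs => ⟨hball ⟨h2 hs, h1 hs⟩, h1 hs⟩

end Gronwall

/-! ### Controlled curves stay in orbits; uniqueness of solutions -/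

section ControlledCurves

variable {n : ℕ} {ι : Type*} {Φ : ι → SmoothFlow (EuclideanSpace ℝ (Fin n))}

local notation "𝔼" => EuclideanSpace ℝ (Fin n)

/-- The projection that kills the first `r` coordinates. -/
noncomputable def tailProj (n r : ℕ) :
    EuclideanSpace ℝ (Fin n) →L[ℝ] EuclideanSpace ℝ (Fin n) :=
  LinearMap.toContinuousLinearMap
    { toFun := fun z => WithLp.toLp 2 fun i => if r ≤ (i : ℕ) then z i else 0
      map_add' := fun z w => by
        ext i
        by_cases hi : r ≤ (i : ℕ) <;> simp [hi]
      map_smul' := fun c z => by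
        ext i
        by_cases hi : r ≤ (i : ℕ) <;> simp [hi] }

lemma tailProj_apply (r : ℕ) (z : 𝔼) (i : Fin n) :
    tailProj n r z i = if r ≤ (i : ℕ) then z i else 0 := rfl

lemma tailProj_eq_zero {r : ℕ} {z : 𝔼} (hz : z ∈ coordSubspace n r) : tailProj n r z = 0 := by
  ext i
  rw [tailProj_apply]
  split_ifs with hi
  · exact hz i hi
  · rfl

lemma sub_tailProj_apply {r : ℕ} (z : 𝔼) {i : Fin n} (hi : r ≤ (i : ℕ)) :
    (z - tailProj n r z) i = 0 := by
  simp [tailProj_apply, hi]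

lemma norm_sub_tailProj_le (r : ℕ) (z : 𝔼) : ‖z - tailProj n r z‖ ≤ ‖z‖ := by
  rw [EuclideanSpace.norm_eq, EuclideanSpace.norm_eq]
  refine Real.sqrt_le_sqrt (Finset.sum_le_sum fun i _ => ?_)
  by_cases hi : r ≤ (i : ℕ)
  · rw [sub_tailProj_apply z hi, norm_zero, zero_pow two_ne_zero]
    positivity
  · simp [tailProj_apply, hi]

lemma exists_uniform_lipschitz {m : ℕ} {η : Fin m → 𝔼 → 𝔼}
    (hη : ∀ i, ContDiffAt ℝ 1 (η i) 0) : ∃ K : Fin m → NNReal, ∃ δ > 0, ∀ i,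
      LipschitzOnWith (K i) (η i) (Metric.ball 0 δ) := by
  choose K s hs hK using fun i => (hη i).exists_lipschitzOnWith
  obtain ⟨δ, hδ, hball⟩ := Metric.mem_nhds_iff.1 (Filter.iInter_mem.2 hs)
  exact ⟨K, δ, hδ, fun i => (hK i).mono (hball.trans (iInter_subset _ i))⟩

/-- A curve controlled by vector fields that are tangent to the orbits stays in one orbit,
locally. -/
lemma eventually_sameOrbit {m : ℕ} {Y : Fin m → 𝔼 → 𝔼} {U : Fin m → Set 𝔼} {V : Set 𝔼}
    (hV : IsOpen V) (hU : ∀ i, IsOpen (U i)) (hY : ∀ i, ContDiffOn ℝ ∞ (Y i) (U i))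
    (htan : ∀ i, ∀ y ∈ U i ∩ V, Y i y ∈ orbitTangent Φ y) {u : Fin m → ℝ → ℝ} {γ : ℝ → 𝔼}
    {a b : ℝ} (hγV : MapsTo γ (Icc a b) V) (hγU : ∀ i, MapsTo γ (Icc a b) (U i))
    (hγ : IsControlledBy Y u γ a b) {t₀ : ℝ} (ht₀ : t₀ ∈ Icc a b) :
    ∀ᶠ t in 𝓝[Icc a b] t₀, SameOrbit Φ (γ t₀) (γ t) := by
  have hab : a ≤ b := ht₀.1.trans ht₀.2
  have hnhds : V ∩ ⋂ i, U i ∈ 𝓝 (γ t₀) :=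
    Filter.inter_mem (hV.mem_nhds (hγV ht₀))
      (Filter.iInter_mem.2 fun i => (hU i).mem_nhds (hγU i ht₀))
  obtain ⟨r, e, hr, ⟨ε, hε, hsrc⟩, he0, htgt, hsmooth, hsymm, hsame, hD⟩ :=
    exists_orbit_chart (Φ := Φ) (γ t₀) hnhds
  have h0 : (0 : 𝔼) ∈ e.source := hsrc ▸ Metric.mem_ball_self hε
  have hpt : γ t₀ ∈ e.target := he0 ▸ e.map_source h0
  have hp0 : e.symm (γ t₀) = 0 := he0 ▸ e.left_inv h0
  obtain ⟨T, hT⟩ : ∃ T, T = tailProj n r := ⟨_, rfl⟩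
  -- The transverse part of `Y i` in the chart. It vanishes on the central slice, where `e` takes
  -- values in the orbit of `γ t₀`, so a Lipschitz bound controls it by the distance `‖T z‖` from
  -- the slice.
  let η : Fin m → 𝔼 → 𝔼 := fun i z => T (fderiv ℝ e.symm (e z) (Y i (e z)))
  have hη : ∀ i, ContDiffAt ℝ 1 (η i) 0 := by
    intro i
    have he : ContDiffAt ℝ ∞ e 0 := hsmooth.contDiffAt
    have htn : e.target ∈ 𝓝 (e 0) := e.open_target.mem_nhds (e.map_source h0)
    have h1 : ContDiffAt ℝ ∞ (fderiv ℝ e.symm) (e 0) :=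
      ((hsymm.fderiv_of_isOpen e.open_target (m := ∞) (by simp)).contDiffAt htn)
    have h2 : ContDiffAt ℝ ∞ (Y i) (e 0) :=
      (hY i).contDiffAt (by rw [he0]; exact (hU i).mem_nhds (hγU i ht₀))
    have h3 : ContDiffAt ℝ ∞ (fun z => fderiv ℝ e.symm (e z) (Y i (e z))) 0 :=
      (ContDiffAt.comp (0 : 𝔼) h1 he).clm_apply (ContDiffAt.comp (0 : 𝔼) h2 he)
    exact (T.contDiff.contDiffAt.comp (0 : 𝔼) h3).of_le (by exact_mod_cast le_top)
  obtain ⟨K, δ', hδ', hK'⟩ := exists_uniform_lipschitz hη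
  obtain ⟨δ, hδ, hδε, hδδ'⟩ : ∃ δ > 0, δ ≤ ε ∧ δ ≤ δ' :=
    ⟨min ε δ', lt_min hε hδ', min_le_left _ _, min_le_right _ _⟩
  have hηbound : ∀ i, ∀ z ∈ Metric.ball (0 : 𝔼) δ, ‖η i z‖ ≤ K i * ‖T z‖ := by
    intro i z hz
    -- Compare `z` with its projection to the slice, which does not increase the norm.
    have hz' : z - T z ∈ Metric.ball (0 : 𝔼) δ := by
      rw [mem_ball_zero_iff] at hz ⊢
      exact hT ▸ (norm_sub_tailProj_le r z).trans_lt hz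
    have hzs : z - T z ∈ e.source := hsrc ▸ Metric.ball_subset_ball hδε hz'
    have hO : SameOrbit Φ (γ t₀) (e (z - T z)) :=
      he0 ▸ hsame 0 (z - T z) fun i hi => hT ▸ (sub_tailProj_apply z hi).symm
    have hmem := htgt (e.map_source hzs)
    have hη0 : η i (z - T z) = 0 :=
      (DFunLike.congr_fun hT _).trans <| tailProj_eq_zero (hD _ hzs hO _
        (htan i _ ⟨mem_iInter.1 hmem.2 i, hmem.1⟩))
    have := (hK' i).norm_sub_le (Metric.ball_subset_ball hδδ' hz)
      (Metric.ball_subset_ball hδδ' hz')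
    rwa [hη0, sub_zero, sub_sub_cancel] at this
  have hsymmAt : ContDiffAt ℝ ∞ e.symm (γ t₀) := hsymm.contDiffAt (e.open_target.mem_nhds hpt)
  obtain ⟨C, W, hW, hC⟩ := (hsymmAt.of_le (m := 1) (by exact_mod_cast le_top)).exists_lipschitzOnWith
  have hγc : ContinuousOn γ (Icc a b) := by
    have := hγ.absCont.continuousOn
    rwa [uIcc_of_le hab] at this
  have hN1 : e.target ∩ W ∩ e.symm ⁻¹' Metric.ball 0 δ ∈ 𝓝 (γ t₀) := by
    refine Filter.inter_mem (Filter.inter_mem (e.open_target.mem_nhds hpt) hW) ?_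
    refine hsymmAt.continuousAt.preimage_mem_nhds ?_
    rw [hp0]
    exact Metric.ball_mem_nhds _ hδ
  have hN := (hγc t₀ ht₀).preimage_mem_nhdsWithin hN1
  have hg : IntervalIntegrable (fun t => ∑ i, K i * |u i t|) volume a b :=
    intervalIntegrable_sum_mul_abs (fun i => K i) hγ.integrable
  filter_upwards [eventually_uIcc_subset ht₀ hN, eventually_abs_integral_lt_one hg ht₀]
    with t hsub hsmall
  have hsubab : uIcc t₀ t ⊆ uIcc a b := by
    rw [uIcc_of_le hab]
    exact fun s hs => (hsub hs).2
  have hAC : AbsolutelyContinuousOnInterval (fun s => T (e.symm (γ s))) t₀ t :=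
    absolutelyContinuousOnInterval_lipschitzOnWith_comp (f := fun y => T (e.symm y))
      (hγ.absCont.mono hsubab) (T.lipschitz.comp_lipschitzOnWith hC) fun s hs => (hsub hs).1.1.2
  have hzero : T (e.symm (γ t)) = 0 := by
    have hg0 : ∀ t, 0 ≤ ∑ i, K i * |u i t| := fun t =>
      Finset.sum_nonneg fun i _ => mul_nonneg (K i).2 (abs_nonneg _)
    refine eq_zero_of_norm_deriv_le_mul (h := fun s => T (e.symm (γ s)))
      (g := fun t => ∑ i, K i * |u i t|) hAC (by simp [hp0]) hg0 (hg.mono_set hsubab) hsmall ?_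
    have hd := hγ.deriv_eq
    rw [ae_restrict_iff' measurableSet_Icc] at hd
    filter_upwards [hd] with s hs hmem
    obtain ⟨⟨⟨hst, -⟩, hsδ⟩, hsab⟩ := hsub hmem
    have h1 : HasFDerivAt e.symm (fderiv ℝ e.symm (γ s)) (γ s) :=
      ((hsymm.contDiffAt (e.open_target.mem_nhds hst)).differentiableAt (by simp)).hasFDerivAt
    have h3 : HasDerivAt (fun s => e.symm (γ s))
        (fderiv ℝ e.symm (γ s) (∑ i, u i s • Y i (γ s))) s := h1.comp_hasDerivAt s (hs hsab)
    have h4 : HasDerivAt (fun s => T (e.symm (γ s)))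
        (T (fderiv ℝ e.symm (γ s) (∑ i, u i s • Y i (γ s)))) s :=
      (T.hasFDerivAt (x := e.symm (γ s))).comp_hasDerivAt s h3
    refine ⟨_, h4, ?_⟩
    simp only [map_sum, map_smul]
    rw [Finset.sum_mul]
    refine norm_sum_le_of_le _ fun i _ => ?_
    have h2 := hηbound i _ hsδ
    simp only [η, e.right_inv hst] at h2
    rw [norm_smul, Real.norm_eq_abs]
    calc |u i s| * ‖T (fderiv ℝ e.symm (γ s) (Y i (γ s)))‖
        ≤ |u i s| * (K i * ‖T (e.symm (γ s))‖) := mul_le_mul_of_nonneg_left h2 (abs_nonneg _)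
      _ = K i * |u i s| * ‖T (e.symm (γ s))‖ := by ring
  have hfin := hsame 0 (e.symm (γ t)) fun i hi => by
    have := congrArg (fun z : 𝔼 => z i) hzero
    simp only [hT, tailProj_apply, hi, if_true] at this
    simpa using this.symm
  rwa [he0, e.right_inv (hsub right_mem_uIcc).1.1.1] at hfin

/-- Lying in the same orbit is an equivalence relation that holds locally along `γ`, hence globally
on a connected interval. -/
lemma sameOrbit_of_isControlledBy {m : ℕ} {Y : Fin m → 𝔼 → 𝔼} {U : Fin m → Set 𝔼} {V : Set 𝔼}
    (hV : IsOpen V) (hU : ∀ i, IsOpen (U i)) (hY : ∀ i, ContDiffOn ℝ ∞ (Y i) (U i))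
    (htan : ∀ i, ∀ y ∈ U i ∩ V, Y i y ∈ orbitTangent Φ y) {u : Fin m → ℝ → ℝ} {γ : ℝ → 𝔼}
    {a b : ℝ} (hab : a ≤ b) (hγV : MapsTo γ (Icc a b) V) (hγU : ∀ i, MapsTo γ (Icc a b) (U i))
    (hγ : IsControlledBy Y u γ a b) : SameOrbit Φ (γ a) (γ b) :=
  isPreconnected_Icc.induction₂ (fun s t => SameOrbit Φ (γ s) (γ t))
    (fun _ ht => eventually_sameOrbit hV hU hY htan hγV hγU hγ ht)
    (fun _ _ _ _ _ _ => SameOrbit.trans) (fun _ _ _ _ => SameOrbit.symm)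
    (left_mem_Icc.2 hab) (right_mem_Icc.2 hab)

/-- Uniqueness for control systems with Lipschitz vector fields and integrable controls. -/
lemma eqOn_of_isControlledBy {m : ℕ} {X : Fin m → 𝔼 → 𝔼} {M : Set 𝔼} {L : ℝ}
    (hlip : ∀ i, ∀ x ∈ M, ∀ y ∈ M, ‖X i x - X i y‖ ≤ L * ‖x - y‖) {u : Fin m → ℝ → ℝ}
    {γ γ' : ℝ → 𝔼} {a b : ℝ} (hab : a ≤ b) (hγM : MapsTo γ (Icc a b) M)
    (hγM' : MapsTo γ' (Icc a b) M) (hγ : IsControlledBy X u γ a b)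
    (hγ' : IsControlledBy X u γ' a b) (h0 : γ a = γ' a) : EqOn γ γ' (Icc a b) := by
  have hg : IntervalIntegrable (fun t => ∑ i, |L| * |u i t|) volume a b :=
    intervalIntegrable_sum_mul_abs (fun _ => |L|) hγ.integrable
  have hloc : ∀ t₀ ∈ Icc a b, ∀ᶠ t in 𝓝[Icc a b] t₀, γ t₀ = γ' t₀ → γ t = γ' t := by
    intro t₀ ht₀
    filter_upwards [eventually_uIcc_subset ht₀ Filter.univ_mem,
      eventually_abs_integral_lt_one hg ht₀] with t hsub hsmall heq
    have hsubab : uIcc t₀ t ⊆ uIcc a b := by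
      rw [uIcc_of_le hab]
      exact fun s hs => (hsub hs).2
    refine sub_eq_zero.1 (eq_zero_of_norm_deriv_le_mul (h := fun s => γ s - γ' s)
      (g := fun t => ∑ i, |L| * |u i t|) ((hγ.absCont.fun_sub hγ'.absCont).mono hsubab)
      (sub_eq_zero.2 heq)
      (fun t => Finset.sum_nonneg fun i _ => by positivity) (hg.mono_set hsubab) hsmall ?_)
    have hd := hγ.deriv_eq
    have hd' := hγ'.deriv_eq
    rw [ae_restrict_iff' measurableSet_Icc] at hd hd'
    filter_upwards [hd, hd'] with s hs hs' hmem
    have hsab := (hsub hmem).2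
    refine ⟨_, (hs hsab).sub (hs' hsab), ?_⟩
    rw [← Finset.sum_sub_distrib, Finset.sum_mul]
    refine norm_sum_le_of_le _ fun i _ => ?_
    rw [← smul_sub, norm_smul, Real.norm_eq_abs]
    calc |u i s| * ‖X i (γ s) - X i (γ' s)‖ ≤ |u i s| * (|L| * ‖γ s - γ' s‖) := by
          gcongr
          refine (hlip i _ (hγM hsab) _ (hγM' hsab)).trans ?_
          gcongr
          exact le_abs_self L
      _ = |L| * |u i s| * ‖γ s - γ' s‖ := by ring
  -- The Grönwall estimate works only for short times; the set of agreement is therefore shown to be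
  -- open and closed.
  have hiff : ∀ s ∈ Icc a b, ∀ t ∈ Icc a b, γ s = γ' s → γ t = γ' t := by
    intro s hs t ht
    have hclosed : IsClosed {x : Icc a b | γ x = γ' x} := by
      have h1 : ContinuousOn γ (Icc a b) := by
        have := hγ.absCont.continuousOn
        rwa [uIcc_of_le hab] at this
      have h2 : ContinuousOn γ' (Icc a b) := by
        have := hγ'.absCont.continuousOn
        rwa [uIcc_of_le hab] at this
      exact isClosed_eq h1.domRestrict h2.domRestrict
    have hopen : IsOpen {x : Icc a b | γ x = γ' x} := by
      refine isOpen_iff_mem_nhds.2 fun x hx => ?_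
      have := hloc x x.2
      rw [nhdsWithin_eq_map_subtype_coe x.2, Filter.eventually_map] at this
      filter_upwards [this] with y hy
      exact hy hx
    intro hst
    have : PreconnectedSpace (Icc a b) := Subtype.preconnectedSpace isPreconnected_Icc
    have huniv := IsClopen.eq_univ ⟨hclosed, hopen⟩ ⟨⟨s, hs⟩, hst⟩
    have hmem : (⟨t, ht⟩ : Icc a b) ∈ {x : Icc a b | γ x = γ' x} := huniv ▸ mem_univ _
    exact hmem
  exact fun t ht => hiff a (left_mem_Icc.2 hab) t ht h0

end ControlledCurves

/-! ### Countably many complete cut-offs of the given fields -/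

section FlowFamily

variable {n : ℕ}

local notation "𝔼" => EuclideanSpace ℝ (Fin n)

/-- A vector field cut off by a bump function supported in its domain has a global flow. -/
lemma exists_smoothFlow_cutoff {X : 𝔼 → 𝔼} {M : Set 𝔼} (hM : IsOpen M)
    (hX : ContDiffOn ℝ ∞ X M) {p : 𝔼} (b : ContDiffBump p)
    (hb : Metric.closedBall p b.rOut ⊆ M) :
    ∃ Φ : SmoothFlow 𝔼, ∀ y, Φ.field y = b y • X y := by
  have hsmooth : ContDiff ℝ ∞ (fun y => b y • X y) := by
    refine contDiff_iff_contDiffAt.2 fun y => ?_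
    by_cases hy : y ∈ tsupport b
    · rw [b.tsupport_eq] at hy
      exact b.contDiff.contDiffAt.smul (hX.contDiffAt (hM.mem_nhds (hb hy)))
    · refine (contDiffAt_const (c := (0 : 𝔼))).congr_of_eventuallyEq ?_
      filter_upwards [notMem_tsupport_iff_eventuallyEq.1 hy] with z hz
      simp [hz]
  have hcs : HasCompactSupport (fun y => b y • X y) := b.hasCompactSupport.smul_right
  obtain ⟨C, hC⟩ := ContDiff.lipschitzWith_of_hasCompactSupport hcs hsmooth (by simp)
  obtain ⟨B, hB⟩ := hcs.exists_bound_of_continuous hsmooth.continuous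
  obtain ⟨Φ, hΦ⟩ := exists_smoothFlow hsmooth hC (B := B.toNNReal)
    (fun x => (hB x).trans (Real.le_coe_toNNReal B))
  refine ⟨Φ, fun y => ?_⟩
  have := (Φ.hasDerivAt_zero y).unique (hΦ y 0)
  simpa [Φ.zero_apply] using this

/-- Countably many cut-offs of the vector fields `X i`, with global flows, which recover
every `X i` at every point of `M`. -/
lemma exists_flowFamily {k : ℕ} {X : Fin k → 𝔼 → 𝔼} {M : Set 𝔼} (hM : IsOpen M)
    (hX : ∀ i, ContDiffOn ℝ ∞ (X i) M) :
    ∃ (ι : Type) (_ : Countable ι) (Φ : ι → SmoothFlow 𝔼) (idx : ι → Fin k) (χ : ι → 𝔼 → ℝ),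
      (∀ a, Continuous (χ a)) ∧ (∀ a y, (Φ a).field y = χ a y • X (idx a) y) ∧
      (∀ a, ∀ y ∉ M, χ a y = 0) ∧ ∀ i, ∀ y ∈ M, ∃ a, idx a = i ∧ χ a y = 1 := by
  have h1 : ∀ p : M, ∃ b : ContDiffBump (p : 𝔼), Metric.closedBall (p : 𝔼) b.rOut ⊆ M := by
    intro p
    obtain ⟨ε, hε, hball⟩ := Metric.nhds_basis_closedBall.mem_iff.1 (hM.mem_nhds p.2)
    exact ⟨⟨ε / 2, ε, half_pos hε, half_lt_self hε⟩, hball⟩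
  choose b hb using h1
  have h2 : ∀ p : M, ((↑) ⁻¹' Metric.closedBall (p : 𝔼) (b p).rIn : Set M) ∈ 𝓝 p := fun p =>
    continuous_subtype_val.continuousAt.preimage_mem_nhds
      (Metric.closedBall_mem_nhds _ (b p).rIn_pos)
  obtain ⟨t, ht, hcover⟩ := TopologicalSpace.countable_cover_nhds h2
  choose Φ hΦ using fun (p : M) (i : Fin k) => exists_smoothFlow_cutoff hM (hX i) (b p) (hb p)
  have : Countable t := ht.to_subtype
  refine ⟨t × Fin k, inferInstance, fun a => Φ a.1 a.2, fun a => a.2, fun a => b a.1,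
    fun a => (b a.1.1).continuous, fun a y => hΦ a.1 a.2 y, fun a y hy => ?_, fun i y hy => ?_⟩
  · refine Function.notMem_support.1 fun h => hy (hb a.1 ?_)
    rw [(b a.1.1).support_eq] at h
    exact Metric.ball_subset_closedBall h
  · have hmem : (⟨y, hy⟩ : M) ∈ ⋃ p ∈ t, ((↑) ⁻¹' Metric.closedBall (p : 𝔼) (b p).rIn : Set M) :=
      hcover ▸ mem_univ _
    obtain ⟨p, hp, hyp⟩ := mem_iUnion₂.1 hmem
    exact ⟨(⟨p, hp⟩, i), rfl, (b p).one_of_mem_closedBall hyp⟩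

end FlowFamily

/-! ### Flows of the cut-off fields preserve `M` -/

section Invariance

variable {E : Type*} [NormedAddCommGroup E] [NormedSpace ℝ E]

/-- By the group law the velocity of the orbit of `q` at time `t` is the differential of the
time-`t` map applied to the field at `q`, which is zero. -/
lemma SmoothFlow.apply_eq_self_of_field_eq_zero (Φ : SmoothFlow E) {q : E} (hq : Φ.field q = 0)
    (t : ℝ) : Φ.toFun t q = q := by
  have hd : ∀ t, HasDerivAt (fun t => Φ.toFun t q) 0 t := by
    intro t
    have h0 := Φ.hasDerivAt_zero q
    rw [hq] at h0
    have hdiff : HasFDerivAt (Φ.toFun t) (fderiv ℝ (Φ.toFun t) (Φ.toFun 0 q)) (Φ.toFun 0 q) :=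
      ((Φ.smooth_apply t).differentiable (by simp) _).hasFDerivAt
    have h1 := HasFDerivAt.comp_hasDerivAt (f := fun s => Φ.toFun s q) (0 : ℝ) hdiff h0
    rw [map_zero, ← sub_self t] at h1
    have h2 := HasDerivAt.comp_sub_const t t h1
    simpa only [Function.comp_def, ← Φ.add_apply, add_sub_cancel] using h2
  have h := is_const_of_deriv_eq_zero (fun t => (hd t).differentiableAt) (fun t => (hd t).deriv) t 0
  rw [h, Φ.zero_apply]

lemma SmoothFlow.apply_mem (Φ : SmoothFlow E) {M : Set E} (h0 : ∀ y ∉ M, Φ.field y = 0) {y : E}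
    (hy : y ∈ M) (t : ℝ) : Φ.toFun t y ∈ M := by
  by_contra hM
  have h := Φ.apply_eq_self_of_field_eq_zero (h0 _ hM) (-t)
  rw [Φ.neg_apply] at h
  exact hM (h ▸ hy)

lemma act_mem {ι : Type*} {Φ : ι → SmoothFlow E} {M : Set E} (h0 : ∀ a, ∀ y ∉ M, (Φ a).field y = 0)
    {y : E} (hy : y ∈ M) (w : List (ι × ℝ)) : act Φ w y ∈ M := by
  induction w with
  | nil => exact hy
  | cons p w ih => exact (Φ p.1).apply_mem (h0 p.1) ih p.2

end Invariance

/-! ### Words in the flows as controlled curves -/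

section Concatenation

variable {n k : ℕ}

local notation "𝔼" => EuclideanSpace ℝ (Fin n)

/-- `y` is reached from `x` in time `T` by a Lipschitz curve in `M` with integrable controls. -/
def ReachesIn (M : Set 𝔼) (X : Fin k → 𝔼 → 𝔼) (x : 𝔼) (T : ℝ) (y : 𝔼) : Prop :=
  ∃ (γ : ℝ → 𝔼) (u : Fin k → ℝ → ℝ) (C : NNReal), γ 0 = x ∧ γ T = y ∧ MapsTo γ (Icc 0 T) M ∧
    LipschitzOnWith C γ (Icc 0 T) ∧ (∀ i, IntervalIntegrable (u i) volume 0 T) ∧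
    ∀ᵐ s ∂(volume.restrict (Icc 0 T)), HasDerivAt γ (∑ i, u i s • X i (γ s)) s

variable {M : Set (EuclideanSpace ℝ (Fin n))}
  {X : Fin k → EuclideanSpace ℝ (Fin n) → EuclideanSpace ℝ (Fin n)}
  {x y : EuclideanSpace ℝ (Fin n)}

lemma reachesIn_refl (hx : x ∈ M) (T : ℝ) : ReachesIn M X x T x :=
  ⟨fun _ => x, fun _ _ => 0, 0, rfl, rfl, fun _ _ => hx, fun _ _ _ _ => by simp,
    fun _ => intervalIntegrable_const, Filter.Eventually.of_forall fun s => by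
      simpa using hasDerivAt_const s x⟩

lemma lipschitzOnWith_Icc_union {F : Type*} [PseudoMetricSpace F] {f : ℝ → F} {a b c : ℝ}
    {C C' : NNReal}
    (h : LipschitzOnWith C f (Icc a b)) (h' : LipschitzOnWith C' f (Icc b c)) (hab : a ≤ b)
    (hbc : b ≤ c) : LipschitzOnWith (max C C') f (Icc a c) := by
  have h1 : LipschitzOnWith (max C C') f (Icc a b) := h.weaken (le_max_left _ _)
  have h2 : LipschitzOnWith (max C C') f (Icc b c) := h'.weaken (le_max_right _ _)
  have key : ∀ s ∈ Icc a c, ∀ t ∈ Icc a c, s ≤ t →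
      dist (f s) (f t) ≤ (max C C' : NNReal) * dist s t := by
    intro s hs t ht hst
    rcases le_total t b with htb | htb
    · exact h1.dist_le_mul s ⟨hs.1, hst.trans htb⟩ t ⟨ht.1, htb⟩
    rcases le_total b s with hsb | hsb
    · exact h2.dist_le_mul s ⟨hsb, hs.2⟩ t ⟨htb, ht.2⟩
    have e : dist s t = dist s b + dist b t := by
      rw [Real.dist_eq, Real.dist_eq, Real.dist_eq, abs_of_nonpos (by linarith),
        abs_of_nonpos (by linarith), abs_of_nonpos (by linarith)]
      ring
    rw [e, mul_add]
    exact (dist_triangle _ (f b) _).trans (add_le_add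
      (h1.dist_le_mul s ⟨hs.1, hsb⟩ b ⟨hab, le_rfl⟩) (h2.dist_le_mul b ⟨le_rfl, hbc⟩ t ⟨htb, ht.2⟩))
  refine LipschitzOnWith.of_dist_le_mul fun s hs t ht => ?_
  rcases le_total s t with hst | hst
  · exact key s hs t ht hst
  · rw [dist_comm, dist_comm s]
    exact key t ht s hs hst

/-- Flow time `t`, of either sign, is run through at constant rate `t / h`. The cut-off is absorbed
into the control `t / h * χ`, continuous along the flow line. -/
lemma ReachesIn.flow {T h : ℝ} (hT : 0 < T) (hh : 0 < h) (hr : ReachesIn M X x T y)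
    (Φ : SmoothFlow 𝔼) {χ : 𝔼 → ℝ} (hχ : Continuous χ) {j : Fin k}
    (hΦ : ∀ z, Φ.field z = χ z • X j z) (h0 : ∀ z ∉ M, χ z = 0) (t : ℝ) :
    ReachesIn M X x (T + h) (Φ.toFun t y) := by
  obtain ⟨γ, u, C, hγ0, hγT, hγM, hγL, hu, hd⟩ := hr
  have hyM : y ∈ M := hγT ▸ hγM ⟨hT.le, le_rfl⟩
  have hTh : T ≤ T + h := by linarith
  set σ : ℝ → 𝔼 := fun s => Φ.toFun (t * (s - T) / h) y with hσ
  have hσT : σ T = y := by simp [hσ, Φ.zero_apply]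
  have hσs : ContDiff ℝ ∞ σ := (Φ.smooth_orbit y).comp (by fun_prop)
  have hσd : ∀ s, HasDerivAt σ ((t / h * χ (σ s)) • X j (σ s)) s := by
    intro s
    have h1 : HasDerivAt (fun s => t * (s - T) / h) (t / h) s := by
      have := ((hasDerivAt_id s).sub_const T).const_mul t |>.div_const h
      simpa using this
    have h2 := HasDerivAt.scomp s (Φ.hasDerivAt (t * (s - T) / h) y) h1
    rw [hΦ, smul_smul] at h2
    exact h2
  set γ' : ℝ → 𝔼 := fun s => if s ≤ T then γ s else σ s with hγ'
  have e1 : ∀ s ≤ T, γ' s = γ s := fun s hs => if_pos hs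
  have e2 : ∀ s, T ≤ s → γ' s = σ s := by
    intro s hs
    rcases hs.eq_or_lt with rfl | hs
    · rw [e1 _ le_rfl, hγT, hσT]
    · exact if_neg hs.not_ge
  obtain ⟨C', hC'⟩ := (hσs.contDiffOn (s := Icc T (T + h))).of_le (m := 1) (by exact_mod_cast le_top)
    |>.exists_lipschitzOnWith (by simp) (convex_Icc _ _) isCompact_Icc
  refine ⟨γ', fun i s => if s ≤ T then u i s else if i = j then t / h * χ (σ s) else 0, max C C',
    ?_, ?_, ?_, ?_, ?_, ?_⟩
  · rw [e1 _ hT.le, hγ0]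
  · rw [e2 _ hTh]
    simp [hσ, hh.ne']
  · intro s hs
    rcases le_total s T with hsT | hsT
    · rw [e1 s hsT]
      exact hγM ⟨hs.1, hsT⟩
    · rw [e2 s hsT]
      exact Φ.apply_mem (fun z hz => by rw [hΦ, h0 z hz, zero_smul]) hyM _
  · refine lipschitzOnWith_Icc_union (b := T) (C := C) (C' := C') (fun s hs r hr => ?_)
      (fun s hs r hr => ?_) hT.le hTh
    · rw [e1 s hs.2, e1 r hr.2]
      exact hγL hs hr
    · rw [e2 s hs.1, e2 r hr.1]
      exact hC' hs hr
  · intro i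
    refine IntervalIntegrable.trans (b := T) ((hu i).congr_uIoo ?_) ?_
    · intro s hs
      rw [uIoo_of_le hT.le] at hs
      simp [hs.2.le]
    · have hc : IntervalIntegrable (fun s => if i = j then t / h * χ (σ s) else 0) volume T (T + h) := by
        by_cases hij : i = j
        · simp only [hij, if_true]
          exact (continuous_const.mul (hχ.comp hσs.continuous)).intervalIntegrable _ _
        · simp [hij]
      refine hc.congr_uIoo ?_
      intro s hs
      rw [uIoo_of_le hTh] at hs
      simp [hs.1.not_ge]
  · rw [ae_restrict_iff' measurableSet_Icc] at hd ⊢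
    -- The glued curve may have a corner at the junction `T`, a null set.
    filter_upwards [hd, Measure.ae_ne volume T] with s hs hsT hmem
    rcases lt_or_gt_of_ne hsT with hlt | hgt
    · have := hs ⟨hmem.1, hlt.le⟩
      simp only [hlt.le, if_true, e1 s hlt.le]
      refine this.congr_of_eventuallyEq ?_
      filter_upwards [Iio_mem_nhds hlt] with r hr
      exact e1 r (le_of_lt hr)
    · simp only [hgt.not_ge, if_false, e2 s hgt.le]
      have : ∑ i, (if i = j then t / h * χ (σ s) else 0) • X i (σ s) =
          (t / h * χ (σ s)) • X j (σ s) := by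
        simp [ite_smul]
      rw [this]
      refine (hσd s).congr_of_eventuallyEq ?_
      filter_upwards [Ioi_mem_nhds hgt] with r hr
      exact e2 r (le_of_lt hr)

/-- Each letter takes time `h`. The extra unit is an initial rest at `x`, which keeps the elapsed
time positive as `ReachesIn.flow` requires. -/
lemma reachesIn_act {ι : Type*} {Φ : ι → SmoothFlow 𝔼} {idx : ι → Fin k} {χ : ι → 𝔼 → ℝ}
    (hχ : ∀ a, Continuous (χ a)) (hΦ : ∀ a z, (Φ a).field z = χ a z • X (idx a) z)
    (h0 : ∀ a, ∀ z ∉ M, χ a z = 0) (hx : x ∈ M) {h : ℝ} (hh : 0 < h) (w : List (ι × ℝ)) :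
    ReachesIn M X x ((w.length + 1) * h) (act Φ w x) := by
  induction w with
  | nil => exact reachesIn_refl hx _
  | cons p w ih =>
    have := ih.flow (by positivity) hh (Φ p.1) (hχ p.1) (hΦ p.1) (h0 p.1) p.2
    rw [act_cons, List.length_cons]
    convert this using 1
    push_cast
    ring

end Concatenation

/-! ### Endpoint map, accessible set and orbit -/

section Endpoint

variable {n k : ℕ} {M : Set (EuclideanSpace ℝ (Fin n))}
  {H : EuclideanSpace ℝ (Fin n) → Submodule ℝ (EuclideanSpace ℝ (Fin n))}
  {X : Fin k → EuclideanSpace ℝ (Fin n) → EuclideanSpace ℝ (Fin n)}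
  {x y : EuclideanSpace ℝ (Fin n)}

/-- Uniqueness is automatic under the Lipschitz bound, so existence of a solution puts a control in
the domain, and the solution chosen in `endpointMap` does not matter. -/
lemma mem_ran_endpointMap {L : ℝ}
    (hlip : ∀ i, ∀ x ∈ M, ∀ y ∈ M, ‖X i x - X i y‖ ≤ L * ‖x - y‖) :
    y ∈ (endpointMap M X x).ran ↔ ∃ u γ, IsSolution M X u x γ ∧ γ 1 = y := by
  have huniq : ∀ u γ γ', IsSolution M X u x γ → IsSolution M X u x γ' → EqOn γ γ' (Icc 0 1) :=
    fun u γ γ' h h' => eqOn_of_isControlledBy hlip zero_le_one h.1 h'.1 h.2.2 h'.2.2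
      (h.2.1.trans h'.2.1.symm)
  constructor
  · rintro ⟨u, h, rfl⟩
    exact ⟨u, h.1.choose, h.1.choose_spec, rfl⟩
  · rintro ⟨u, γ, hγ, rfl⟩
    have h : (u, x) ∈ solvableSet M X := ⟨⟨γ, hγ⟩, huniq u⟩
    exact ⟨u, h, huniq u _ _ h.1.choose_spec hγ ⟨zero_le_one, le_rfl⟩⟩

lemma IsSolution.mem_accessibleSet (hM : IsOpen M) (hX : ∀ i, ContDiffOn ℝ ∞ (X i) M)
    (hspan : SpannedBy M H X) {u : Controls k} {γ : ℝ → EuclideanSpace ℝ (Fin n)}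
    (h : IsSolution M X u x γ) : γ 1 ∈ accessibleSet M H x := by
  refine ⟨0, 1, γ, zero_le_one, ⟨h.1, 1, fun j => j, Nat.mono_cast, by simp, by simp, ?_⟩, h.2.1,
    rfl⟩
  intro j hj
  obtain rfl : j = 0 := by omega
  refine ⟨k, fun _ => M, X, fun i t => u t i, fun i => ⟨hM, subset_rfl, hX i, fun y hy => ?_⟩,
    fun _ => ?_, ?_⟩
  · rw [hspan y hy]
    exact Submodule.subset_span ⟨i, rfl⟩
  · simpa using h.1
  · simpa using h.2.2

lemma ReachesIn.exists_isSolution (h : ReachesIn M X x 1 y) :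
    ∃ u γ, IsSolution M X u x γ ∧ γ 1 = y := by
  obtain ⟨γ, u, C, hγ0, hγ1, hγM, hγL, hu, hd⟩ := h
  have hint : ∀ i, Integrable (u i) (volume.restrict (Icc (0 : ℝ) 1)) := fun i =>
    (intervalIntegrable_iff_integrableOn_Icc_of_le zero_le_one).1 (hu i)
  have hmem : MemLp (fun s => WithLp.toLp 2 fun i => u i s : ℝ → EuclideanSpace ℝ (Fin k)) 1
      (volume.restrict (Icc (0 : ℝ) 1)) :=
    memLp_one_iff_integrable.2 (Integrable.of_eval_piLp hint)
  have hae := hmem.coeFn_toLp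
  refine ⟨hmem.toLp _, γ, ⟨hγM, hγ0, ?_, fun i => ?_, ?_⟩, hγ1⟩
  · refine LipschitzOnWith.absolutelyContinuousOnInterval (K := C) ?_
    rwa [uIcc_of_le zero_le_one]
  · rw [intervalIntegrable_iff_integrableOn_Icc_of_le zero_le_one]
    refine (hint i).congr ?_
    filter_upwards [hae] with s hs
    rw [hs]
  · filter_upwards [hae, hd] with s hs hds
    simpa only [hs] using hds

lemma sameOrbit_of_mem_accessibleSet {ι : Type*} {Φ : ι → SmoothFlow (EuclideanSpace ℝ (Fin n))}
    (hM : IsOpen M) (htan : ∀ y ∈ M, H y ≤ orbitTangent Φ y) (hy : y ∈ accessibleSet M H x) :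
    SameOrbit Φ x y := by
  obtain ⟨a, b, γ, hab, ⟨hγM, N, t, ht, rfl, rfl, hpieces⟩, rfl, rfl⟩ := hy
  suffices ∀ j ≤ N, SameOrbit Φ (γ (t 0)) (γ (t j)) from this N le_rfl
  intro j
  induction j with
  | zero => exact fun _ => .refl _
  | succ j ih =>
    intro hj
    obtain ⟨m, U, Y, u, hY, hγU, hγ⟩ := hpieces j hj
    refine (ih (by omega)).trans (sameOrbit_of_isControlledBy hM (fun i => (hY i).isOpen)
      (fun i => (hY i).smooth) (fun i y hy => htan y hy.2 ((hY i).horizontal y hy.1))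
      (ht j.le_succ) (fun s hs => hγM ⟨(ht j.zero_le).trans hs.1, hs.2.trans (ht hj)⟩) hγU hγ)

end Endpoint

end SubRiem

/-! ### The main theorem -/

theorem mainTheorem10 {n k : ℕ}
    (M : Set (EuclideanSpace ℝ (Fin n))) (hM : IsOpen M) (hMconn : IsConnected M)
    (H : EuclideanSpace ℝ (Fin n) → Submodule ℝ (EuclideanSpace ℝ (Fin n)))
    (X : Fin k → EuclideanSpace ℝ (Fin n) → EuclideanSpace ℝ (Fin n))
    (hX : ∀ i, ContDiffOn ℝ ∞ (X i) M)
    (hspan : SubRiem.SpannedBy M H X)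
    (hbound : ∃ K : ℝ, ∀ i, ∀ x ∈ M, ‖X i x‖ ≤ K)
    (hlip : ∃ L : ℝ, ∀ i, ∀ x ∈ M, ∀ y ∈ M, ‖X i x - X i y‖ ≤ L * ‖x - y‖)
    (x : EuclideanSpace ℝ (Fin n)) (hx : x ∈ M) :
    SubRiem.accessibleSet M H x = (SubRiem.endpointMap M X x).ran ∧
      SubRiem.IsInitialSubmanifold M (SubRiem.endpointMap M X x).ran ∧
      ∀ (U : Set (EuclideanSpace ℝ (Fin n)))
        (Y : EuclideanSpace ℝ (Fin n) → EuclideanSpace ℝ (Fin n)),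
        SubRiem.IsLocalHorizontal M H U Y →
          ∀ y ∈ U ∩ (SubRiem.endpointMap M X x).ran,
            SubRiem.IsTangentAt M (SubRiem.endpointMap M X x).ran y (Y y) := by
  obtain ⟨L, hlip⟩ := hlip
  obtain ⟨ι, hι, Φ, idx, χ, hχ, hΦ, h0, hcov⟩ := SubRiem.exists_flowFamily hM hX
  have hfield : ∀ i, ∀ y ∈ M, ∃ a, (Φ a).field y = X i y := by
    intro i y hy
    obtain ⟨a, rfl, ha⟩ := hcov i y hy
    exact ⟨a, by rw [hΦ, ha, one_smul]⟩
  have htan : ∀ y ∈ M, H y ≤ SubRiem.orbitTangent Φ y := by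
    intro y hy
    rw [hspan y hy, Submodule.span_le]
    rintro _ ⟨i, rfl⟩
    obtain ⟨a, ha⟩ := hfield i y hy
    change X i y ∈ SubRiem.orbitTangent Φ y
    rw [← ha]
    exact SubRiem.field_mem_orbitTangent Φ a y
  have hran : SubRiem.accessibleSet M H x ⊆ {y | SubRiem.SameOrbit Φ x y} := fun y hy =>
    SubRiem.sameOrbit_of_mem_accessibleSet hM htan hy
  have hacc : (SubRiem.endpointMap M X x).ran ⊆ SubRiem.accessibleSet M H x := by
    intro y hy
    obtain ⟨u, γ, hγ, rfl⟩ := (SubRiem.mem_ran_endpointMap hlip).1 hy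
    exact hγ.mem_accessibleSet hM hX hspan
  have horb : {y | SubRiem.SameOrbit Φ x y} ⊆ (SubRiem.endpointMap M X x).ran := by
    rintro _ ⟨w, rfl⟩
    refine (SubRiem.mem_ran_endpointMap hlip).2 (SubRiem.ReachesIn.exists_isSolution ?_)
    -- This step length makes the total time equal to `1`.
    have h := SubRiem.reachesIn_act hχ hΦ h0 hx (h := ((w.length : ℝ) + 1)⁻¹) (by positivity) w
    rwa [mul_inv_cancel₀ (by positivity)] at h
  have heq : (SubRiem.endpointMap M X x).ran = {y | SubRiem.SameOrbit Φ x y} :=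
    (hacc.trans hran).antisymm horb
  have hsub : {y | SubRiem.SameOrbit Φ x y} ⊆ M := by
    rintro _ ⟨w, rfl⟩
    exact SubRiem.act_mem (fun a z hz => by rw [hΦ, h0 a z hz, zero_smul]) hx w
  refine ⟨(hran.trans horb).antisymm hacc, heq ▸ SubRiem.isInitialSubmanifold_orbit hM x hsub, ?_⟩
  rw [heq]
  rintro U Y hY y ⟨hyU, hy⟩ φ r hφ
  have hyM := hY.subset hyU
  -- Tangency is a linear condition, so it suffices to check the spanning vectors `X i y`, each the
  -- value at `y` of a generator whose cut-off equals one there.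
  have hle : H y ≤ (SubRiem.coordSubspace n r).comap (fderiv ℝ φ y).toLinearMap := by
    rw [hspan y hyM, Submodule.span_le]
    rintro _ ⟨i, rfl⟩
    obtain ⟨a, ha⟩ := hfield i y hyM
    change fderiv ℝ φ y (X i y) ∈ SubRiem.coordSubspace n r
    rw [← ha]
    exact SubRiem.fderiv_field_mem_coordSubspace hy hφ a
  exact hle (hY.horizontal y hyU)
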